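/- An infinite word is a right infinite word $\omega=\omega_0\omega_1\omega_2\cdots$; its factors of length $n$ are the finite words $\omega_i\omega_{i+1}\cdots\omega_{i+n-1}$, $i\ge 0$. The subword complexity of $\omega$ is the function $\rho_\omega:\mathbb N\to\mathbb N$ such that $\rho_\omega(n)$ is the number of distinct factors of $\omega$ of length $n$. The abelian complexity of $\omega$ is the function $\rho^{\mathrm{ab}}_\omega:\mathbb N\to\mathbb N$ such that $\rho^{\mathrm{ab}}_\omega(n)$ is the number of classes of factors of $\omega$ of length $n$ under abelian equivalence, where two finite words are abelian equivalent if every letter occurs equally often in both. Let $\mathbf{TM}_0$ be the Thue–Morse word, i.e. the fixed point beginning in $0$ of the morphism $0\mapsto 01$, $1\mapsto 10$. The shift orbit closure of $\mathbf{TM}_0$ is the closure of $\{S^k(\mathbf{TM}_0) : k\ge 0\}$ in $\{0,1\}^{\mathbb N}$ with the product topology, where $S(\omega_0\omega_1\omega_2\cdots)=\omega_1\omega_2\cdots$. **Corollary 6.3.** Let $\omega\in\{0,1\}^{\mathbb N}$. Then $\rho_\omega=\rho_{\mathbf{TM}_0}$ and $\rho^{\mathrm{ab}}_\omega=\rho^{\mathrm{ab}}_{\mathbf{TM}_0}$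 if and only if $\omega$ lies in the shift orbit closure of $\mathbf{TM}_0$. -/

import Mathlib

namespace AbelianWords

/-- The word `ω_i ω_{i+1} ⋯ ω_{i+n-1}`: the factor of length `n` of the right infinite word `ω`
that starts at position `i`. -/
def factor {A : Type*} (ω : ℕ → A) (i n : ℕ) : List A :=
  (List.range n).map fun j => ω (i + j)

/-- The set of all factors of length `n` of `ω`. -/
def factors {A : Type*} (ω : ℕ → A) (n : ℕ) : Set (List A) :=
  {u | ∃ i, u = factor ω i n}

/-- The subword complexity function of `ω`: the number of factors of length `n`. -/
noncomputable def subwordComplexity {A : Type*} (ω : ℕ → A) (n : ℕ) : ℕ :=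
  (factors ω n).ncard

/-- Abelian equivalence of finite words: every letter occurs equally often in both. -/
def abelianSetoid (A : Type*) [DecidableEq A] : Setoid (List A) where
  r u v := ∀ a, u.count a = v.count a
  iseqv := ⟨fun _ _ => rfl, fun h a => (h a).symm, fun h k a => (h a).trans (k a)⟩

/-- The abelian complexity function of `ω`: the number of classes of factors of length `n`
modulo abelian equivalence. -/
noncomputable def abelianComplexity {A : Type*} [DecidableEq A] (ω : ℕ → A) (n : ℕ) : ℕ :=
  Nat.card (Quotient ((abelianSetoid A).comap (Subtype.val : factors ω n → List A)))

/-- The shift map on right infinite words, deleting the first letter. -/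
def shift {A : Type*} (ω : ℕ → A) : ℕ → A := fun n => ω (n + 1)

/-- The closure, in the product topology (with the discrete topology on the alphabet), of the
set of all iterated shifts of `ω`. -/
def shiftOrbitClosure {A : Type*} [TopologicalSpace A] [DiscreteTopology A] (ω : ℕ → A) :
    Set (ℕ → A) :=
  closure (Set.range fun k : ℕ => shift^[k] ω)

/-- `ν` is the image of the infinite word `ω` under the (nonerasing) morphism with letter images
`f`: the image of every prefix of `ω` is a prefix of `ν`. -/
def IsMorphicImage {A B : Type*} (f : A → List B) (ω : ℕ → A) (ν : ℕ → B) : Prop :=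
  ∀ n, (factor ω 0 n).flatMap f = factor ν 0 ((factor ω 0 n).flatMap f).length

/-- The Thue–Morse morphism `0 ↦ 01`, `1 ↦ 10`. -/
def thueMorseMorphism : Fin 2 → List (Fin 2) := ![[0, 1], [1, 0]]

theorem thueMorseMorphism_eq (a : Fin 2) : thueMorseMorphism a = [a, a + 1] := by
  revert a; decide

theorem factor_succ {A : Type*} (ω : ℕ → A) (i n : ℕ) :
    factor ω i (n + 1) = factor ω i n ++ [ω (i + n)] := by
  simp [factor, List.range_succ]

theorem length_factor {A : Type*} (ω : ℕ → A) (i n : ℕ) : (factor ω i n).length = n := by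
  simp [factor]

theorem length_flatMap_thueMorseMorphism (u : List (Fin 2)) :
    (u.flatMap thueMorseMorphism).length = 2 * u.length := by
  induction u with
  | nil => rfl
  | cons a u ih =>
    rw [List.flatMap_cons, List.length_append, ih, thueMorseMorphism_eq]
    simp; omega

theorem isMorphicImage_thueMorseMorphism_iff (ω ν : ℕ → Fin 2) :
    IsMorphicImage thueMorseMorphism ω ν ↔
      ∀ n, ν (2 * n) = ω n ∧ ν (2 * n + 1) = ω n + 1 := by
  have step : ∀ n, (factor ω 0 (n + 1)).flatMap thueMorseMorphism =
      (factor ω 0 n).flatMap thueMorseMorphism ++ [ω n, ω n + 1] := by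
    intro n
    simp [factor_succ, thueMorseMorphism_eq]
  have step' : ∀ n, factor ν 0 (2 * (n + 1)) =
      factor ν 0 (2 * n) ++ [ν (2 * n), ν (2 * n + 1)] := by
    intro n
    rw [show 2 * (n + 1) = 2 * n + 1 + 1 by ring, factor_succ, factor_succ]
    simp
  simp only [IsMorphicImage, length_flatMap_thueMorseMorphism, length_factor]
  constructor
  · intro h n
    have h1 := h (n + 1)
    rw [step, step', h n] at h1
    have h2 := List.append_cancel_left h1
    simp at h2
    exact ⟨h2.1.symm, h2.2.symm⟩
  · intro h n
    induction n with
    | zero => rfl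
    | succ n ih => rw [step, step', ih, (h n).1, (h n).2]

theorem existsUnique_thueMorse :
    ∃! t : ℕ → Fin 2, t 0 = 0 ∧ IsMorphicImage thueMorseMorphism t t := by
  simp only [isMorphicImage_thueMorseMorphism_iff]
  refine ⟨fun n => (Nat.digits 2 n).sum • (1 : Fin 2), ⟨by simp, fun n => ?_⟩, ?_⟩
  · constructor
    · rcases Nat.eq_zero_or_pos n with rfl | hn
      · simp
      · show (Nat.digits 2 (2 * n)).sum • (1 : Fin 2) = _
        rw [Nat.digits_def' (by norm_num) (by omega)]
        simp
    · show (Nat.digits 2 (2 * n + 1)).sum • (1 : Fin 2) = (Nat.digits 2 n).sum • (1 : Fin 2) + 1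
      rw [Nat.digits_def' (by norm_num) (by omega)]
      rw [show (2 * n + 1) % 2 = 1 by omega, show (2 * n + 1) / 2 = n by omega]
      rw [List.sum_cons, add_smul, add_comm, one_smul]
  · rintro s ⟨h0, hs⟩
    funext n
    induction n using Nat.strong_induction_on with
    | _ n ih =>
      rcases Nat.eq_zero_or_pos n with rfl | hn
      · simpa using h0
      · rw [Nat.digits_def' (by norm_num) hn, List.sum_cons, add_smul,
          ← ih (n / 2) (by omega)]
        rcases Nat.mod_two_eq_zero_or_one n with h | h
        · rw [h, zero_smul, zero_add, ← (hs (n / 2)).1]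
          congr 1; omega
        · rw [h, one_smul, add_comm, ← (hs (n / 2)).2]
          congr 1; omega

/-- The Thue–Morse word: the fixed point, beginning in `0`, of the Thue–Morse morphism. -/
noncomputable def thueMorse : ℕ → Fin 2 := existsUnique_thueMorse.choose

theorem thueMorse_spec :
    thueMorse 0 = 0 ∧ IsMorphicImage thueMorseMorphism thueMorse thueMorse :=
  existsUnique_thueMorse.choose_spec.1

end AbelianWords

/-! Call a word aligned if it is an image under the Thue–Morse morphism, possibly with its first
letter deleted. The abelian complexity serves only to align ω. Both 00 and 11 occur and windows of
odd length are balanced, so all squares of letters start at positions of one parity; at the other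
parity neighbouring letters differ, and the word splits into blocks 01 and 10
(`aligned_of_abelianComplexity`).

From there subword complexity suffices. Counting the factors of `doubling x` by the parity of their
starting position shows that x contains no cube of a letter and again has the Thue–Morse complexity
from length two on (`cubeFree_of_thueMorseComplexity`, `ThueMorseComplexity.desubstitute`). Nothing
is known about the abelian complexity of x, so x is aligned by another argument: the numbers of
right special factors of lengths four to nine leave only one possible list of factors of length five
(`aligned_of_cubeFree`). Desubstitution can therefore be iterated. It roughly halves the length of a
factor, down to length two, where every binary word is a Thue–Morse factor
(`exists_occurrence_thueMorse`). So every prefix of ω is a Thue–Morse factor, which is membership in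
the closure.

Conversely, prefixes of the Thue–Morse word recur with bounded gaps, so each word in the closure has
exactly the Thue–Morse factors. -/

namespace AbelianWords

/-! ### Factors of infinite words -/

section Factors

variable {A : Type*}

theorem factor_eq_factor_iff (ω ν : ℕ → A) (i j n : ℕ) :
    factor ω i n = factor ν j n ↔ ∀ l < n, ω (i + l) = ν (j + l) := by
  simp [factor]

theorem factor_succ_left (ω : ℕ → A) (i n : ℕ) :
    factor ω i (n + 1) = ω i :: factor ω (i + 1) n := by
  simp [factor, List.range_succ_eq_map, Function.comp_def, add_assoc, add_comm 1]

theorem factors_eq_range (ω : ℕ → A) (n : ℕ) :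
    factors ω n = Set.range fun i => factor ω i n := by
  ext u; simp [factors, eq_comm]

theorem factor_mem_factors (ω : ℕ → A) (i n : ℕ) : factor ω i n ∈ factors ω n := ⟨i, rfl⟩

theorem length_of_mem_factors {ω : ℕ → A} {n : ℕ} {u : List A} (h : u ∈ factors ω n) :
    u.length = n := by
  obtain ⟨i, rfl⟩ := h; exact length_factor ω i n

theorem factors_finite [Finite A] (ω : ℕ → A) (n : ℕ) : (factors ω n).Finite :=
  (List.finite_length_eq A n).subset fun _ hu => length_of_mem_factors hu

theorem shift_iterate_apply (ω : ℕ → A) (p m : ℕ) : shift^[p] ω m = ω (m + p) := by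
  induction p generalizing ω with
  | zero => rfl
  | succ p ih => rw [Function.iterate_succ_apply, ih, shift]; congr 1

theorem factor_shift_iterate (ω : ℕ → A) (p i n : ℕ) :
    factor (shift^[p] ω) i n = factor ω (i + p) n := by
  rw [factor_eq_factor_iff]
  intro l _
  rw [shift_iterate_apply]; congr 1; omega

/-- A factor that is not a prefix extends to the left. -/
theorem cons_mem_factors_or_eq_prefix {ω : ℕ → A} {n : ℕ} {u : List A} (h : u ∈ factors ω n) :
    (∃ a, a :: u ∈ factors ω (n + 1)) ∨ u = factor ω 0 n := by
  obtain ⟨i, rfl⟩ := h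
  rcases i with _ | i
  · exact Or.inr rfl
  · exact Or.inl ⟨ω i, i, (factor_succ_left ω i n).symm⟩

theorem mem_factors_of_append_singleton {ω : ℕ → A} {n : ℕ} {u : List A} {a : A}
    (h : u ++ [a] ∈ factors ω (n + 1)) : u ∈ factors ω n := by
  obtain ⟨i, hi⟩ := h
  rw [factor_succ] at hi
  exact ⟨i, (List.append_inj' hi rfl).1⟩

theorem mem_factors_of_cons {ω : ℕ → A} {n : ℕ} {u : List A} {a : A}
    (h : a :: u ∈ factors ω (n + 1)) : u ∈ factors ω n := by
  obtain ⟨i, hi⟩ := h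
  rw [factor_succ_left] at hi
  exact ⟨i + 1, (List.cons.inj hi).2⟩

theorem append_singleton_mem_factors {ω : ℕ → A} {n : ℕ} {u : List A} (h : u ∈ factors ω n) :
    ∃ a, u ++ [a] ∈ factors ω (n + 1) := by
  obtain ⟨i, rfl⟩ := h
  exact ⟨ω (i + n), i, (factor_succ ω i n).symm⟩

theorem ncard_range_eq_of_fibers {α β γ : Type*} (f : α → β) (g : α → γ)
    (h : ∀ i j, f i = f j ↔ g i = g j) : (Set.range f).ncard = (Set.range g).ncard := by
  have e : Quotient (Setoid.ker f) ≃ Set.range f := Setoid.quotientKerEquivRange f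
  have e' : Quotient (Setoid.ker g) ≃ Set.range g := Setoid.quotientKerEquivRange g
  have hk : Setoid.ker f = Setoid.ker g := by
    ext i j; exact h i j
  rw [← Nat.card_coe_set_eq, ← Nat.card_coe_set_eq, ← Nat.card_congr e, ← Nat.card_congr e', hk]

theorem subwordComplexity_eq_ncard_range (ω : ℕ → A) (n : ℕ) :
    subwordComplexity ω n = (Set.range fun i => factor ω i n).ncard := by
  rw [subwordComplexity, factors_eq_range]

end Factors

/-! ### Factors of images under the Thue–Morse morphism -/

theorem fin_two_eq_or (a b : Fin 2) : a = b ∨ a = b + 1 := by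
  revert a b; decide

theorem fin_two_add_one_add_one (a : Fin 2) : a + 1 + 1 = a := by
  revert a; decide

theorem fin_two_ne_iff {a b : Fin 2} : a ≠ b ↔ b = a + 1 := by
  revert a b; decide

theorem fin_two_add_one_ne (a : Fin 2) : a + 1 ≠ a := by
  revert a; decide

/-- The image of an infinite word under the Thue–Morse morphism. -/
def doubling (x : ℕ → Fin 2) (m : ℕ) : Fin 2 := if m % 2 = 0 then x (m / 2) else x (m / 2) + 1

theorem doubling_even (x : ℕ → Fin 2) (n : ℕ) : doubling x (2 * n) = x n := by
  simp [doubling]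

theorem doubling_odd (x : ℕ → Fin 2) (n : ℕ) : doubling x (2 * n + 1) = x n + 1 := by
  have h1 : (2 * n + 1) % 2 = 1 := by omega
  have h2 : (2 * n + 1) / 2 = n := by omega
  simp [doubling, h1, h2]

/-- A word contains no cube of a letter. -/
def CubeFree (x : ℕ → Fin 2) : Prop := ∀ i, ¬(x i = x (i + 1) ∧ x (i + 1) = x (i + 2))

/-- Factors of the image of `x` of length `m` starting at even positions at least `2p`. -/
def evenFactors (x : ℕ → Fin 2) (p m : ℕ) : Set (List (Fin 2)) :=
  Set.range fun i => factor (doubling x) (2 * (i + p)) m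

/-- Factors of the image of `x` of length `m` starting at odd positions. -/
def oddFactors (x : ℕ → Fin 2) (m : ℕ) : Set (List (Fin 2)) :=
  Set.range fun i => factor (doubling x) (2 * i + 1) m

/-- Deleting one letter loses only the start at position 0, which is even; the odd starts are
unaffected. -/
theorem factors_shift_doubling (x : ℕ → Fin 2) {p : ℕ} (hp : p < 2) (m : ℕ) :
    factors (shift^[p] (doubling x)) m = evenFactors x p m ∪ oddFactors x m := by
  ext u
  simp only [factors, factor_shift_iterate, Set.mem_ofPred_eq, evenFactors, oddFactors,
    Set.mem_union, Set.mem_range]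
  constructor
  · rintro ⟨i, rfl⟩
    rcases Nat.even_or_odd' (i + p) with ⟨c, hc | hc⟩
    · refine Or.inl ⟨c - p, ?_⟩
      rw [hc]; congr 1; omega
    · exact Or.inr ⟨c, by rw [hc]⟩
  · rintro (⟨i, rfl⟩ | ⟨i, rfl⟩)
    · exact ⟨2 * i + p, by congr 1; omega⟩
    · exact ⟨2 * i + 1 - p, by congr 1; omega⟩

theorem factor_doubling_eq_iff (x : ℕ → Fin 2) (i j e m : ℕ) :
    factor (doubling x) (2 * i + e) m = factor (doubling x) (2 * j + e) m ↔
      ∀ l < m, x (i + (e + l) / 2) = x (j + (e + l) / 2) := by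
  rw [factor_eq_factor_iff]
  refine forall₂_congr fun l _ => ?_
  have h (i : ℕ) : doubling x (2 * i + e + l) =
      if (e + l) % 2 = 0 then x (i + (e + l) / 2) else x (i + (e + l) / 2) + 1 := by
    rw [doubling]
    rw [show (2 * i + e + l) % 2 = (e + l) % 2 by omega,
      show (2 * i + e + l) / 2 = i + (e + l) / 2 by omega]
  rw [h, h]
  split_ifs <;> simp

/-- At a fixed parity a factor determines, and is determined by, the letters of `x` whose blocks it
meets; from an even position these are ⌈m/2⌉ letters. -/
theorem ncard_evenFactors (x : ℕ → Fin 2) (p m : ℕ) :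
    (evenFactors x p m).ncard = subwordComplexity (shift^[p] x) ((m + 1) / 2) := by
  rw [subwordComplexity_eq_ncard_range, evenFactors]
  refine ncard_range_eq_of_fibers _ _ fun i j => ?_
  rw [factor_shift_iterate, factor_shift_iterate, factor_eq_factor_iff x]
  refine (factor_doubling_eq_iff x (i + p) (j + p) 0 m).trans ⟨fun h l hl => ?_, fun h l hl => ?_⟩
  · have := h (2 * l) (by omega)
    rwa [show (0 + 2 * l) / 2 = l by omega] at this
  · exact h _ (by omega)

/-- From an odd position the factor starts with half a block, so it meets ⌊m/2⌋ + 1 blocks; this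
fails for the empty factor. -/
theorem ncard_oddFactors (x : ℕ → Fin 2) {m : ℕ} (hm : 1 ≤ m) :
    (oddFactors x m).ncard = subwordComplexity x (m / 2 + 1) := by
  rw [subwordComplexity_eq_ncard_range, oddFactors]
  refine ncard_range_eq_of_fibers _ _ fun i j => ?_
  rw [factor_eq_factor_iff x, factor_doubling_eq_iff]
  refine ⟨fun h l hl => ?_, fun h l hl => h _ (by omega)⟩
  rcases l with _ | l
  · simpa using h 0 hm
  · have := h (2 * l + 1) (by omega)
    rwa [show (1 + (2 * l + 1)) / 2 = l + 1 by omega] at this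

theorem evenFactors_finite (x : ℕ → Fin 2) (p m : ℕ) : (evenFactors x p m).Finite :=
  (List.finite_length_eq (Fin 2) m).subset <| by rintro _ ⟨i, rfl⟩; exact length_factor _ _ _

theorem oddFactors_finite (x : ℕ → Fin 2) (m : ℕ) : (oddFactors x m).Finite :=
  (List.finite_length_eq (Fin 2) m).subset <| by rintro _ ⟨i, rfl⟩; exact length_factor _ _ _

theorem subwordComplexity_shift_doubling (x : ℕ → Fin 2) {p m : ℕ} (hp : p < 2) (hm : 1 ≤ m) :
    subwordComplexity (shift^[p] (doubling x)) m + (evenFactors x p m ∩ oddFactors x m).ncard =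
      subwordComplexity (shift^[p] x) ((m + 1) / 2) + subwordComplexity x (m / 2 + 1) := by
  rw [← ncard_evenFactors, ← ncard_oddFactors x hm, subwordComplexity, factors_shift_doubling x hp]
  exact Set.ncard_union_add_ncard_inter _ _ (evenFactors_finite x p m) (oddFactors_finite x m)

/-- A long factor occurring at positions of both parities is alternating and comes from a power
of a letter on either side. -/
theorem doubling_overlap {x : ℕ → Fin 2} {i j m : ℕ} (hm : 4 ≤ m)
    (h : factor (doubling x) (2 * i) m = factor (doubling x) (2 * j + 1) m) :
    x (i + 1) = x i ∧ x j = x i + 1 ∧ x (j + 1) = x i + 1 ∧ x (j + 2) = x i + 1 := by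
  rw [factor_eq_factor_iff] at h
  have h0 := h 0 (by omega)
  have h1 := h 1 (by omega)
  have h2 := h 2 (by omega)
  have h3 := h 3 (by omega)
  rw [show 2 * i + 0 = 2 * i by omega, show 2 * j + 1 + 0 = 2 * j + 1 by omega, doubling_even,
    doubling_odd] at h0
  rw [show 2 * j + 1 + 1 = 2 * (j + 1) by omega, doubling_even, doubling_odd] at h1
  rw [show 2 * i + 2 = 2 * (i + 1) by omega, show 2 * j + 1 + 2 = 2 * (j + 1) + 1 by omega,
    doubling_even, doubling_odd] at h2
  rw [show 2 * i + 3 = 2 * (i + 1) + 1 by omega, show 2 * j + 1 + 3 = 2 * (j + 2) by omega,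
    doubling_even, doubling_odd] at h3
  generalize x i = a at *
  generalize x (i + 1) = b at *
  generalize x j = c at *
  generalize x (j + 1) = d at *
  generalize x (j + 2) = e at *
  revert a b c d e; decide

theorem overlap_eq_empty {x : ℕ → Fin 2} (hx : CubeFree x) (p : ℕ) {m : ℕ} (hm : 4 ≤ m) :
    evenFactors x p m ∩ oddFactors x m = ∅ := by
  rw [Set.eq_empty_iff_forall_notMem]
  rintro _ ⟨⟨i, rfl⟩, j, hj⟩
  obtain ⟨-, h1, h2, h3⟩ := doubling_overlap hm hj.symm
  exact hx j ⟨h1.trans h2.symm, h2.trans h3.symm⟩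

/-! ### The Thue–Morse word -/

theorem thueMorse_even (n : ℕ) : thueMorse (2 * n) = thueMorse n :=
  ((isMorphicImage_thueMorseMorphism_iff _ _).1 thueMorse_spec.2 n).1

theorem thueMorse_odd (n : ℕ) : thueMorse (2 * n + 1) = thueMorse n + 1 :=
  ((isMorphicImage_thueMorseMorphism_iff _ _).1 thueMorse_spec.2 n).2

theorem doubling_thueMorse : doubling thueMorse = thueMorse := by
  funext m
  rcases Nat.even_or_odd' m with ⟨c, rfl | rfl⟩
  · rw [doubling_even, thueMorse_even]
  · rw [doubling_odd, thueMorse_odd]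

theorem doubling_cubeFree (x : ℕ → Fin 2) : CubeFree (doubling x) := by
  rintro i ⟨h1, h2⟩
  rcases Nat.even_or_odd' i with ⟨c, rfl | rfl⟩
  · rw [doubling_even, doubling_odd] at h1
    exact fin_two_add_one_ne _ h1.symm
  · rw [show 2 * c + 1 + 1 = 2 * (c + 1) by omega, show 2 * c + 1 + 2 = 2 * (c + 1) + 1 by omega,
      doubling_even, doubling_odd] at h2
    exact fin_two_add_one_ne _ h2.symm

theorem thueMorse_cubeFree : CubeFree thueMorse :=
  doubling_thueMorse ▸ doubling_cubeFree thueMorse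

theorem thueMorse_values : thueMorse 0 = 0 ∧ thueMorse 1 = 1 ∧ thueMorse 2 = 1 ∧ thueMorse 3 = 0 ∧
    thueMorse 4 = 1 ∧ thueMorse 5 = 0 ∧ thueMorse 6 = 0 ∧ thueMorse 7 = 1 := by
  have h0 := thueMorse_spec.1
  have h1 : thueMorse 1 = 1 := by simpa [h0] using thueMorse_odd 0
  have h2 : thueMorse 2 = 1 := by simpa [h1] using thueMorse_even 1
  have h3 : thueMorse 3 = 0 := by simpa [h1] using thueMorse_odd 1
  have h4 : thueMorse 4 = 1 := by simpa [h2] using thueMorse_even 2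
  have h5 : thueMorse 5 = 0 := by simpa [h2] using thueMorse_odd 2
  have h6 : thueMorse 6 = 0 := by simpa [h3] using thueMorse_even 3
  have h7 : thueMorse 7 = 1 := by simpa [h3] using thueMorse_odd 3
  exact ⟨h0, h1, h2, h3, h4, h5, h6, h7⟩

/-- The binary words of length `n`. -/
def binaryWords : ℕ → List (List (Fin 2))
  | 0 => [[]]
  | n + 1 => (binaryWords n).map (List.cons 0) ++ (binaryWords n).map (List.cons 1)

theorem mem_binaryWords (u : List (Fin 2)) : u ∈ binaryWords u.length := by
  induction u with
  | nil => simp [binaryWords]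
  | cons a u ih =>
    rcases fin_two_eq_or a 0 with rfl | rfl <;> simp [binaryWords, ih]

/-- No letter occurs three times in a row in the list. -/
def cubeFreeList : List (Fin 2) → Bool
  | a :: b :: c :: u => !(a == b && b == c) && cubeFreeList (b :: c :: u)
  | _ => true

theorem CubeFree.cubeFreeList_factor {x : ℕ → Fin 2} (hx : CubeFree x) (i n : ℕ) :
    cubeFreeList (factor x i n) = true := by
  induction n generalizing i with
  | zero => rfl
  | succ n ih =>
    rcases n with _ | _ | n
    · rfl
    · rfl
    · have h1 := ih (i + 1)
      rw [factor_succ_left] at h1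
      rw [factor_succ_left, factor_succ_left, factor_succ_left, cubeFreeList]
      rw [factor_succ_left] at h1
      rw [h1, Bool.and_true]
      simpa [imp_iff_not_or] using hx i

theorem CubeFree.factors_subset {x : ℕ → Fin 2} (hx : CubeFree x) (n : ℕ) :
    factors x n ⊆ ((binaryWords n).filter cubeFreeList).toFinset := by
  rintro _ ⟨i, rfl⟩
  have h := mem_binaryWords (factor x i n)
  rw [length_factor] at h
  simp [h, hx.cubeFreeList_factor]

theorem factors_thueMorse_two : factors thueMorse 2 = (binaryWords 2).toFinset := by
  obtain ⟨h0, h1, h2, h3, h4, h5, h6, h7⟩ := thueMorse_values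
  refine Set.Subset.antisymm ?_ ?_
  · rintro _ ⟨i, rfl⟩
    have h := mem_binaryWords (factor thueMorse i 2)
    rw [length_factor] at h
    simpa using h
  · intro u hu
    have : u = [0, 0] ∨ u = [0, 1] ∨ u = [1, 0] ∨ u = [1, 1] := by
      simpa [binaryWords] using hu
    rcases this with rfl | rfl | rfl | rfl
    · exact ⟨5, by simp [factor, List.range_succ, *]⟩
    · exact ⟨0, by simp [factor, List.range_succ, *]⟩
    · exact ⟨2, by simp [factor, List.range_succ, *]⟩
    · exact ⟨1, by simp [factor, List.range_succ, *]⟩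

theorem factors_thueMorse_three :
    factors thueMorse 3 = ((binaryWords 3).filter cubeFreeList).toFinset := by
  obtain ⟨h0, h1, h2, h3, h4, h5, h6, h7⟩ := thueMorse_values
  refine Set.Subset.antisymm (thueMorse_cubeFree.factors_subset 3) ?_
  intro u hu
  have h : (binaryWords 3).filter cubeFreeList =
    [[0, 0, 1], [0, 1, 0], [0, 1, 1], [1, 0, 0], [1, 0, 1], [1, 1, 0]] := by decide
  have : u = [0, 0, 1] ∨ u = [0, 1, 0] ∨ u = [0, 1, 1] ∨ u = [1, 0, 0] ∨ u = [1, 0, 1] ∨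
      u = [1, 1, 0] := by
    simpa [h] using hu
  rcases this with rfl | rfl | rfl | rfl | rfl | rfl
  · exact ⟨5, by simp [factor, List.range_succ, *]⟩
  · exact ⟨3, by simp [factor, List.range_succ, *]⟩
  · exact ⟨0, by simp [factor, List.range_succ, *]⟩
  · exact ⟨4, by simp [factor, List.range_succ, *]⟩
  · exact ⟨2, by simp [factor, List.range_succ, *]⟩
  · exact ⟨1, by simp [factor, List.range_succ, *]⟩

theorem subwordComplexity_thueMorse_rec {m : ℕ} (hm : 4 ≤ m) :
    subwordComplexity thueMorse m =
      subwordComplexity thueMorse ((m + 1) / 2) + subwordComplexity thueMorse (m / 2 + 1) := by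
  have h := subwordComplexity_shift_doubling thueMorse (p := 0) (m := m) (by omega) (by omega)
  rw [overlap_eq_empty thueMorse_cubeFree 0 hm, doubling_thueMorse] at h
  simpa using h

theorem subwordComplexity_thueMorse_values :
    subwordComplexity thueMorse 2 = 4 ∧ subwordComplexity thueMorse 3 = 6 ∧
    subwordComplexity thueMorse 4 = 10 ∧ subwordComplexity thueMorse 5 = 12 ∧
    subwordComplexity thueMorse 6 = 16 ∧ subwordComplexity thueMorse 7 = 20 ∧
    subwordComplexity thueMorse 8 = 22 ∧ subwordComplexity thueMorse 9 = 24 ∧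
    subwordComplexity thueMorse 10 = 28 := by
  have h2 : subwordComplexity thueMorse 2 = 4 := by
    rw [subwordComplexity, factors_thueMorse_two, Set.ncard_coe_finset]; decide
  have h3 : subwordComplexity thueMorse 3 = 6 := by
    rw [subwordComplexity, factors_thueMorse_three, Set.ncard_coe_finset]; decide
  have h4 := subwordComplexity_thueMorse_rec (m := 4) (by omega)
  have h5 := subwordComplexity_thueMorse_rec (m := 5) (by omega)
  have h6 := subwordComplexity_thueMorse_rec (m := 6) (by omega)
  have h7 := subwordComplexity_thueMorse_rec (m := 7) (by omega)
  have h8 := subwordComplexity_thueMorse_rec (m := 8) (by omega)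
  have h9 := subwordComplexity_thueMorse_rec (m := 9) (by omega)
  have h10 := subwordComplexity_thueMorse_rec (m := 10) (by omega)
  norm_num at h4 h5 h6 h7 h8 h9 h10
  omega

/-! ### Abelian complexity and alignment -/

/-- The number of occurrences of the letter `1` in a factor. -/
def ones (ω : ℕ → Fin 2) (i n : ℕ) : ℕ := (factor ω i n).count 1

theorem count_zero_add_count_one (u : List (Fin 2)) : u.count 0 + u.count 1 = u.length := by
  induction u with
  | nil => rfl
  | cons a u ih =>
    rcases fin_two_eq_or a 0 with rfl | rfl
    · rw [List.count_cons_self, List.count_cons_of_ne (by decide), List.length_cons]; omega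
    · rw [zero_add, List.count_cons_self, List.count_cons_of_ne (by decide), List.length_cons]
      omega

theorem abelianComplexity_eq_ncard_range (ω : ℕ → Fin 2) (n : ℕ) :
    abelianComplexity ω n = (Set.range fun i => ones ω i n).ncard := by
  have hk : (abelianSetoid (Fin 2)).comap (Subtype.val : factors ω n → List (Fin 2)) =
      Setoid.ker fun u : factors ω n => (u : List (Fin 2)).count 1 := by
    ext u v
    change (∀ a, _) ↔ (u : List (Fin 2)).count 1 = (v : List (Fin 2)).count 1
    refine ⟨fun h => h 1, fun h a => ?_⟩
    have hu := count_zero_add_count_one (u : List (Fin 2))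
    have hv := count_zero_add_count_one (v : List (Fin 2))
    rw [length_of_mem_factors u.2] at hu
    rw [length_of_mem_factors v.2] at hv
    rcases fin_two_eq_or a 0 with rfl | rfl
    · omega
    · exact h
  rw [abelianComplexity, hk, Nat.card_congr (Setoid.quotientKerEquivRange _),
    Nat.card_coe_set_eq]
  congr 1
  ext k
  constructor
  · rintro ⟨⟨_, i, rfl⟩, rfl⟩
    exact ⟨i, rfl⟩
  · rintro ⟨i, rfl⟩
    exact ⟨⟨_, i, rfl⟩, rfl⟩

theorem factor_add {A : Type*} (ω : ℕ → A) (i n m : ℕ) :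
    factor ω i (n + m) = factor ω i n ++ factor ω (i + n) m := by
  induction m with
  | zero => simp [factor]
  | succ m ih => rw [← add_assoc, factor_succ, ih, factor_succ, List.append_assoc, add_assoc]

theorem ones_add (ω : ℕ → Fin 2) (i n m : ℕ) :
    ones ω i (n + m) = ones ω i n + ones ω (i + n) m := by
  rw [ones, factor_add, List.count_append, ones, ones]

theorem ones_one (ω : ℕ → Fin 2) (i : ℕ) : ones ω i 1 = (ω i).val := by
  rcases fin_two_eq_or (ω i) 0 with h | h <;> simp [ones, factor, h]

theorem ones_two (ω : ℕ → Fin 2) (i : ℕ) : ones ω i 2 = (ω i).val + (ω (i + 1)).val := by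
  rw [← ones_one, ← ones_one, ← ones_add]

theorem ones_shift_le (ω : ℕ → Fin 2) (i n : ℕ) :
    ones ω (i + 1) n ≤ ones ω i n + 1 ∧ ones ω i n ≤ ones ω (i + 1) n + 1 := by
  have h1 := ones_add ω i 1 n
  have h2 := ones_add ω i n 1
  rw [ones_one] at h1 h2
  have := (ω i).isLt
  have := (ω (i + n)).isLt
  rw [add_comm 1 n] at h1
  omega

/-- If the numbers of ones in windows of a given length take values on both sides of a
threshold, they take the two values next to it. -/
theorem exists_ones_eq_threshold {ω : ℕ → Fin 2} {n k i j : ℕ} (hi : ones ω i n ≤ k)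
    (hj : k + 1 ≤ ones ω j n) :
    (∃ l, ones ω l n = k) ∧ ∃ l, ones ω l n = k + 1 := by
  by_contra hcon
  have key : ∀ l, ones ω l n ≤ k ↔ ones ω (l + 1) n ≤ k := by
    intro l
    have h := ones_shift_le ω l n
    constructor
    · intro hl
      by_contra hl'
      exact hcon ⟨⟨l, by omega⟩, l + 1, by omega⟩
    · intro hl
      by_contra hl'
      exact hcon ⟨⟨l + 1, by omega⟩, l, by omega⟩
  have all : ∀ l, ones ω l n ≤ k ↔ ones ω 0 n ≤ k := by
    intro l
    induction l with
    | zero => rfl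
    | succ l ih => rw [← key, ih]
  have := (all j).2 ((all i).1 hi)
  omega

/-- Induction on n: prolonging 00 by a balanced window gives at most n + 1 ones, prolonging 11 gives
at least n + 2. Both values then occur, and abelian complexity two leaves room for no other. -/
theorem ones_odd_balanced {ω : ℕ → Fin 2} {i₀ i₁ : ℕ} (h00 : ones ω i₀ 2 = 0)
    (h11 : ones ω i₁ 2 = 2) (hab : ∀ n, abelianComplexity ω (2 * n + 1) = 2) (n i : ℕ) :
    ones ω i (2 * n + 1) = n ∨ ones ω i (2 * n + 1) = n + 1 := by
  induction n generalizing i with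
  | zero =>
    have := (ω i).isLt
    rw [show 2 * 0 + 1 = 1 from rfl, ones_one]; omega
  | succ n ih =>
    have hlow : ones ω i₀ (2 * (n + 1) + 1) ≤ n + 1 := by
      rw [show 2 * (n + 1) + 1 = 2 + (2 * n + 1) by omega, ones_add, h00]
      rcases ih (i₀ + 2) with h | h <;> omega
    have hhigh : n + 1 + 1 ≤ ones ω i₁ (2 * (n + 1) + 1) := by
      rw [show 2 * (n + 1) + 1 = 2 + (2 * n + 1) by omega, ones_add, h11]
      rcases ih (i₁ + 2) with h | h <;> omega
    obtain ⟨⟨a, ha⟩, b, hb⟩ := exists_ones_eq_threshold hlow hhigh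
    have hc := hab (n + 1)
    rw [abelianComplexity_eq_ncard_range] at hc
    have hsub : ({n + 1, n + 1 + 1} : Set ℕ) ⊆
        Set.range fun i => ones ω i (2 * (n + 1) + 1) := by
      rintro k (rfl | rfl)
      · exact ⟨a, ha⟩
      · exact ⟨b, hb⟩
    have heq := Set.eq_of_subset_of_ncard_le hsub
      (by rw [hc, Set.ncard_pair (by omega)]) (Set.finite_of_ncard_pos (by omega))
    have : ones ω i (2 * (n + 1) + 1) ∈ ({n + 1, n + 1 + 1} : Set ℕ) := by
      rw [heq]; exact ⟨i, rfl⟩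
    simpa using this

/-- Squares of letters at an odd distance make some window of odd length unbalanced. -/
theorem not_square_at_odd_distance {ω : ℕ → Fin 2}
    (hb : ∀ n i, ones ω i (2 * n + 1) = n ∨ ones ω i (2 * n + 1) = n + 1) {i : ℕ}
    (hi : ω i = ω (i + 1)) (j : ℕ) : ω (i + 2 * j + 1) ≠ ω (i + 2 * j + 2) := by
  intro hj
  have e1 := ones_two ω i
  have e2 := ones_two ω (i + 2 * j + 1)
  rw [show i + 2 * j + 1 + 1 = i + 2 * j + 2 by omega, ← hj] at e2
  rw [← hi] at e1
  have l1 := (ω i).isLt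
  have l2 := (ω (i + 2 * j + 1)).isLt
  rcases j with _ | j
  -- The squares overlap in a cube, a window of length three with no or three ones.
  · have h1 := hb 1 i
    have e3 := ones_add ω i 2 1
    rw [ones_one, show i + 2 = i + 2 * 0 + 2 from rfl, ← hj,
      show i + 2 * 0 + 1 = i + 1 from rfl, ← hi] at e3
    rw [show 2 * 1 + 1 = 2 + 1 from rfl] at h1
    omega
  -- Let w, of odd length, lie between the squares aa and bb. If a = b, the window aawbb is
  -- unbalanced; if a ≠ b, the windows aaw and wbb require different numbers of ones in w.
  · have h1 := hb (j + 1) i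
    have h2 := hb (j + 1) (i + 2)
    have h3 := hb j (i + 2)
    have h4 := hb (j + 2) i
    have a1 := ones_add ω i 2 (2 * j + 1)
    have a2 := ones_add ω (i + 2) (2 * j + 1) 2
    have a3 := ones_add ω i 2 (2 * (j + 1) + 1)
    rw [show i + 2 + (2 * j + 1) = i + 2 * (j + 1) + 1 by omega] at a2
    rw [show 2 + (2 * j + 1) = 2 * (j + 1) + 1 by omega] at a1
    rw [show 2 * j + 1 + 2 = 2 * (j + 1) + 1 by omega] at a2
    rw [show 2 + (2 * (j + 1) + 1) = 2 * (j + 2) + 1 by omega] at a3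
    omega

/-- The word is, up to deleting a first letter, an image under the Thue–Morse morphism. -/
def Aligned (ω : ℕ → Fin 2) : Prop := ∃ p < 2, ∃ x, ω = shift^[p] (doubling x)

theorem aligned_of_parity {ω : ℕ → Fin 2} {q : ℕ} (h : ∀ n, n % 2 = q % 2 → ω n ≠ ω (n + 1)) :
    Aligned ω := by
  rcases Nat.mod_two_eq_zero_or_one q with hq | hq
  · refine ⟨0, by omega, fun n => ω (2 * n), ?_⟩
    funext m
    rw [Function.iterate_zero, id]
    rcases Nat.even_or_odd' m with ⟨c, rfl | rfl⟩
    · rw [doubling_even]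
    · rw [doubling_odd]; exact fin_two_ne_iff.1 (h (2 * c) (by omega))
  -- Here `ω 0` is the second letter of a block whose first letter was deleted, so the preimage
  -- starts with the complement of `ω 0`.
  · refine ⟨1, by omega, fun n => if n = 0 then ω 0 + 1 else ω (2 * n - 1), ?_⟩
    funext m
    rw [shift_iterate_apply]
    rcases Nat.even_or_odd' m with ⟨c, rfl | rfl⟩
    · rw [doubling_odd]
      rcases c with _ | c
      · exact (fin_two_add_one_add_one _).symm
      · exact fin_two_ne_iff.1 (h (2 * c + 1) (by omega))
    · rw [show 2 * c + 1 + 1 = 2 * (c + 1) by omega, doubling_even, if_neg (by omega)]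
      congr 1

theorem aligned_of_abelianComplexity {ω : ℕ → Fin 2} (h2 : abelianComplexity ω 2 = 3)
    (hab : ∀ n, abelianComplexity ω (2 * n + 1) = 2) : Aligned ω := by
  have hsub : (Set.range fun i => ones ω i 2) ⊆ ((Finset.range 3 : Finset ℕ) : Set ℕ) := by
    rintro _ ⟨i, rfl⟩
    have := (ω i).isLt
    have := (ω (i + 1)).isLt
    have := ones_two ω i
    simp only [Finset.coe_range, Set.mem_Iio]; omega
  rw [abelianComplexity_eq_ncard_range] at h2
  have heq := Set.eq_of_subset_of_ncard_le hsub
    (by rw [h2, Set.ncard_coe_finset, Finset.card_range]) (Finset.finite_toSet _)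
  obtain ⟨i₀, h00⟩ : 0 ∈ Set.range fun i => ones ω i 2 := by rw [heq]; simp
  obtain ⟨i₁, h11⟩ : 2 ∈ Set.range fun i => ones ω i 2 := by rw [heq]; simp
  have hb := ones_odd_balanced h00 h11 hab
  have hsq : ω i₁ = ω (i₁ + 1) := by
    have := (ω i₁).isLt
    have := (ω (i₁ + 1)).isLt
    have h := ones_two ω i₁
    simp only at h11
    apply Fin.ext; omega
  -- A square at the parity opposite to `i₁` would be at odd distance from the square at `i₁`, on
  -- one side or the other.
  refine aligned_of_parity (q := i₁ + 1) fun n hn hn' => ?_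
  rcases Nat.lt_or_ge n i₁ with hlt | hge
  · have h := not_square_at_odd_distance hb hn' ((i₁ - n - 1) / 2)
    rw [show n + 2 * ((i₁ - n - 1) / 2) + 1 = i₁ by omega,
      show n + 2 * ((i₁ - n - 1) / 2) + 2 = i₁ + 1 by omega] at h
    exact h hsq
  · have h := not_square_at_odd_distance hb hsq ((n - i₁ - 1) / 2)
    rw [show i₁ + 2 * ((n - i₁ - 1) / 2) + 1 = n by omega,
      show i₁ + 2 * ((n - i₁ - 1) / 2) + 2 = n + 1 by omega] at h
    exact h hn'

theorem fin_two_val_add_val (a : Fin 2) : a.val + (a + 1).val = 1 := by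
  revert a; decide

theorem ones_doubling_even (x : ℕ → Fin 2) (i n : ℕ) : ones (doubling x) (2 * i) (2 * n) = n := by
  induction n with
  | zero => rfl
  | succ n ih =>
    rw [show 2 * (n + 1) = 2 * n + 2 by omega, ones_add, ih, ones_two,
      show 2 * i + 2 * n = 2 * (i + n) by omega, doubling_even, doubling_odd]
    rw [fin_two_val_add_val]

theorem abelianComplexity_thueMorse_two : abelianComplexity thueMorse 2 = 3 := by
  obtain ⟨h0, h1, h2, h3, h4, h5, h6, h7⟩ := thueMorse_values
  rw [abelianComplexity_eq_ncard_range]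
  have : (Set.range fun i => ones thueMorse i 2) = ((Finset.range 3 : Finset ℕ) : Set ℕ) := by
    ext k
    simp only [Finset.coe_range, Set.mem_Iio, Set.mem_range]
    constructor
    · rintro ⟨i, rfl⟩
      have := (thueMorse i).isLt
      have := (thueMorse (i + 1)).isLt
      have := ones_two thueMorse i
      omega
    · intro hk
      interval_cases k
      · exact ⟨5, by simp [ones_two, *]⟩
      · exact ⟨0, by simp [ones_two, *]⟩
      · exact ⟨1, by simp [ones_two, *]⟩
  rw [this, Set.ncard_coe_finset, Finset.card_range]

/-- A window of length 2n + 1 consists of n whole blocks, each with exactly one 1, and a single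
letter at one end. -/
theorem abelianComplexity_thueMorse_odd (n : ℕ) :
    abelianComplexity thueMorse (2 * n + 1) = 2 := by
  have he (i : ℕ) : ones thueMorse (2 * i) (2 * n + 1) = n + (thueMorse (i + n)).val := by
    rw [ones_add, ones_one, show 2 * i + 2 * n = 2 * (i + n) by omega, thueMorse_even]
    conv_lhs => rw [← doubling_thueMorse, ones_doubling_even]
    rw [doubling_thueMorse]
  have ho (i : ℕ) : ones thueMorse (2 * i + 1) (2 * n + 1) = (thueMorse i + 1).val + n := by
    rw [show 2 * n + 1 = 1 + 2 * n by omega, ones_add, ones_one, thueMorse_odd,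
      show 2 * i + 1 + 1 = 2 * (i + 1) by omega]
    conv_lhs => rw [← doubling_thueMorse, ones_doubling_even]
    rw [doubling_thueMorse]
  rw [abelianComplexity_eq_ncard_range]
  have : (Set.range fun i => ones thueMorse i (2 * n + 1)) = {n, n + 1} := by
    ext k
    simp only [Set.mem_range, Set.mem_insert_iff, Set.mem_singleton_iff]
    constructor
    · rintro ⟨i, rfl⟩
      rcases Nat.even_or_odd' i with ⟨c, rfl | rfl⟩
      · rw [he]
        have := (thueMorse (c + n)).isLt
        omega
      · rw [ho]
        have := (thueMorse c + 1).isLt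
        omega
    · obtain ⟨h0, h1, -⟩ := thueMorse_values
      rintro (rfl | rfl)
      · exact ⟨2 * 1 + 1, by rw [ho, h1]; simp⟩
      · exact ⟨2 * 0 + 1, by rw [ho, h0, add_comm]; simp⟩
  rw [this, Set.ncard_pair (by omega)]

/-! ### Desubstitution -/

/-- The subword complexities at all lengths from two on are those of the Thue–Morse word. -/
def ThueMorseComplexity (ω : ℕ → Fin 2) : Prop :=
  ∀ n, 2 ≤ n → subwordComplexity ω n = subwordComplexity thueMorse n

theorem factors_shift_subset {A : Type*} (x : ℕ → A) (p m : ℕ) :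
    factors (shift^[p] x) m ⊆ factors x m := by
  rintro _ ⟨i, rfl⟩
  exact ⟨i + p, factor_shift_iterate x p i m⟩

theorem factors_subset_insert_shift {A : Type*} (x : ℕ → A) {p : ℕ} (hp : p < 2) (m : ℕ) :
    factors x m ⊆ insert (factor x 0 m) (factors (shift^[p] x) m) := by
  rintro _ ⟨i, rfl⟩
  rcases Nat.eq_zero_or_pos i with rfl | hi
  · exact Or.inl rfl
  · exact Or.inr ⟨i - p, by rw [factor_shift_iterate]; congr 1; omega⟩

theorem subwordComplexity_shift_le (x : ℕ → Fin 2) {p : ℕ} (hp : p < 2) (m : ℕ) :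
    subwordComplexity (shift^[p] x) m ≤ subwordComplexity x m ∧
      subwordComplexity x m ≤ subwordComplexity (shift^[p] x) m + 1 :=
  ⟨Set.ncard_le_ncard (factors_shift_subset x p m) (factors_finite x m),
    (Set.ncard_le_ncard (factors_subset_insert_shift x hp m)
      ((factors_finite _ m).insert _)).trans (Set.ncard_insert_le _ _)⟩

theorem factors_subset_binaryWords (x : ℕ → Fin 2) (n : ℕ) :
    factors x n ⊆ (binaryWords n).toFinset := by
  rintro _ ⟨i, rfl⟩
  have h := mem_binaryWords (factor x i n)
  rw [length_factor] at h
  simpa using h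

theorem subwordComplexity_two_le (x : ℕ → Fin 2) : subwordComplexity x 2 ≤ 4 := by
  refine (Set.ncard_le_ncard (factors_subset_binaryWords x 2) (Finset.finite_toSet _)).trans ?_
  rw [Set.ncard_coe_finset]; decide

theorem exists_square_of_subwordComplexity_two {x : ℕ → Fin 2} (h : subwordComplexity x 2 = 4)
    (a : Fin 2) : ∃ i, x i = a ∧ x (i + 1) = a := by
  have heq := Set.eq_of_subset_of_ncard_le (factors_subset_binaryWords x 2)
    (by rw [Set.ncard_coe_finset]; exact (show _ ≤ 4 by decide).trans h.ge)
    (Finset.finite_toSet _)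
  have hmem : [a, a] ∈ factors x 2 := by
    rw [heq]
    simpa using mem_binaryWords [a, a]
  obtain ⟨i, hi⟩ := hmem
  refine ⟨i, ?_⟩
  simp only [factor, List.range_succ, List.range_zero] at hi
  simpa [eq_comm] using hi

/-- Converse to `doubling_overlap` at length four: the image of aa, and the image of the
complementary cube read from its second letter, both begin abab. -/
theorem alternating_mem_overlap {x : ℕ → Fin 2} {p i j : ℕ} {a : Fin 2}
    (h0 : shift^[p] x i = a) (h1 : shift^[p] x (i + 1) = a)
    (hj : x j = a + 1) (hj1 : x (j + 1) = a + 1) (hj2 : x (j + 2) = a + 1) :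
    [a, a + 1, a, a + 1] ∈ evenFactors x p 4 ∩ oddFactors x 4 := by
  rw [shift_iterate_apply] at h0 h1
  refine ⟨⟨i, ?_⟩, j, ?_⟩
  · have e0 := doubling_even x (i + p)
    have e1 := doubling_odd x (i + p)
    have e2 := doubling_even x (i + 1 + p)
    have e3 := doubling_odd x (i + 1 + p)
    rw [h0] at e0 e1
    rw [h1] at e2 e3
    rw [show 2 * (i + 1 + p) = 2 * (i + p) + 2 by omega] at e2 e3
    simp [factor, List.range_succ, e0, e1, e2]
    simpa using e3
  · have e0 := doubling_odd x j
    have e1 := doubling_even x (j + 1)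
    have e2 := doubling_odd x (j + 1)
    have e3 := doubling_even x (j + 2)
    rw [hj, fin_two_add_one_add_one] at e0
    rw [hj1] at e1 e2
    rw [fin_two_add_one_add_one] at e2
    rw [hj2] at e3
    simp only [factor, List.range_succ, List.range_zero, List.nil_append,
      List.map_cons, List.map_nil, List.cons_append]
    rw [show 2 * j + 1 + 1 = 2 * (j + 1) by omega, show 2 * j + 1 + 2 = 2 * (j + 1) + 1 by omega,
      show 2 * j + 1 + 3 = 2 * (j + 2) by omega, add_zero, e0, e1, e2, e3]

/-- The fifth letter reaches a third block on the even side as well, so cubes of both letters are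
needed. -/
theorem overlap_five {x : ℕ → Fin 2} {p : ℕ} {u : List (Fin 2)}
    (hu : u ∈ evenFactors x p 5 ∩ oddFactors x 5) :
    ∃ a, u = [a, a + 1, a, a + 1, a] ∧
      (∃ i, shift^[p] x i = a ∧ shift^[p] x (i + 1) = a ∧ shift^[p] x (i + 2) = a) ∧
      ∃ j, x j = a + 1 ∧ x (j + 1) = a + 1 ∧ x (j + 2) = a + 1 := by
  obtain ⟨⟨i, rfl⟩, j, hj⟩ := hu
  simp only at hj ⊢
  obtain ⟨h1, h2, h3, h4⟩ := doubling_overlap (by omega) hj.symm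
  have h5 : x (i + p + 2) = x (i + p) := by
    have := (factor_eq_factor_iff _ _ _ _ _).1 hj 4 (by omega)
    rw [show 2 * j + 1 + 4 = 2 * (j + 2) + 1 by omega, doubling_odd, h4,
      fin_two_add_one_add_one, show 2 * (i + p) + 4 = 2 * (i + p + 2) by omega,
      doubling_even] at this
    exact this.symm
  refine ⟨x (i + p), ?_, ⟨i, ?_⟩, j, h2, h3, h4⟩
  · simp only [factor, List.range_succ, List.range_zero, List.nil_append,
      List.map_cons, List.map_nil, List.cons_append]
    rw [show 2 * (i + p) + 2 = 2 * (i + p + 1) by omega,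
      show 2 * (i + p) + 3 = 2 * (i + p + 1) + 1 by omega,
      show 2 * (i + p) + 4 = 2 * (i + p + 2) by omega, add_zero, doubling_even, doubling_odd,
      doubling_even, doubling_odd, doubling_even, h1, h5]
  · rw [shift_iterate_apply, shift_iterate_apply, shift_iterate_apply]
    refine ⟨rfl, ?_, ?_⟩
    · rw [← h1]; congr 1; omega
    · rw [← h5]; congr 1; omega

theorem ncard_overlap_five_le (x : ℕ → Fin 2) (p : ℕ) :
    (evenFactors x p 5 ∩ oddFactors x 5).ncard ≤ (evenFactors x p 4 ∩ oddFactors x 4).ncard := by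
  refine Set.ncard_le_ncard_of_injOn (List.take 4) ?_ ?_
    ((evenFactors_finite x p 4).inter_of_left _)
  · intro u hu
    obtain ⟨a, rfl, ⟨i, hi, hi1, -⟩, j, hj, hj1, hj2⟩ := overlap_five hu
    exact alternating_mem_overlap hi hi1 hj hj1 hj2
  · intro u hu v hv huv
    obtain ⟨a, rfl, -⟩ := overlap_five hu
    obtain ⟨b, rfl, -⟩ := overlap_five hv
    simp only [List.take_succ_cons, List.take_zero, List.cons.injEq] at huv
    rw [huv.1]

/-- Write y for `shift^[p] x`, ρ for subword complexity and k₄ ≥ k₅ for the sizes of the overlaps.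
The counts are 10 + k₄ = ρ_y(2) + ρ_x(3) and 12 + k₅ = ρ_y(3) + ρ_x(3), where ρ_x(3) ≤ ρ_y(3) + 1.
They force ρ_y(2) = 4 and 2k₄ ≤ k₅ + 1, hence k₄ ≤ 1. A cube would make k₄ positive, then k₅
positive, and then k₄ at least two. -/
theorem cubeFree_of_thueMorseComplexity {x : ℕ → Fin 2} {p : ℕ} (hp : p < 2)
    (h : ThueMorseComplexity (shift^[p] (doubling x))) : CubeFree x := by
  obtain ⟨-, -, v4, v5, -⟩ := subwordComplexity_thueMorse_values
  have h4 := subwordComplexity_shift_doubling x (p := p) (m := 4) hp (by omega)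
  have h5 := subwordComplexity_shift_doubling x (p := p) (m := 5) hp (by omega)
  rw [h 4 (by omega), v4] at h4
  rw [h 5 (by omega), v5] at h5
  norm_num at h4 h5
  have hk := ncard_overlap_five_le x p
  have hfin : (evenFactors x p 4 ∩ oddFactors x 4).Finite :=
    (evenFactors_finite x p 4).inter_of_left _
  have hy2 := subwordComplexity_two_le (shift^[p] x)
  have hs := subwordComplexity_shift_le x hp 3
  have hy : subwordComplexity (shift^[p] x) 2 = 4 := by omega
  have hsq := exists_square_of_subwordComplexity_two hy
  rintro j ⟨hj, hj'⟩
  have hpos : 0 < (evenFactors x p 4 ∩ oddFactors x 4).ncard := by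
    rw [Set.ncard_pos hfin]
    obtain ⟨i, hi, hi1⟩ := hsq (x j + 1)
    have e := fin_two_add_one_add_one (x j)
    exact ⟨_, alternating_mem_overlap (j := j) hi hi1 e.symm (by rw [← hj, e])
      (by rw [← hj', ← hj, e])⟩
  have hk5 : 0 < (evenFactors x p 5 ∩ oddFactors x 5).ncard := by omega
  rw [Set.ncard_pos ((evenFactors_finite x p 5).inter_of_left _)] at hk5
  obtain ⟨u, hu⟩ := hk5
  obtain ⟨a, -, ⟨i, hi, hi1, hi2⟩, j', hj0, hj1, hj2⟩ := overlap_five hu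
  have m1 := alternating_mem_overlap hi hi1 hj0 hj1 hj2
  obtain ⟨l, hl, hl1⟩ := hsq (a + 1)
  rw [shift_iterate_apply] at hi hi1 hi2
  have e := fin_two_add_one_add_one a
  have m2 := alternating_mem_overlap (j := i + p) hl hl1 (by rw [hi, e])
    (by rw [show i + p + 1 = i + 1 + p by omega, hi1, e])
    (by rw [show i + p + 2 = i + 2 + p by omega, hi2, e])
  -- Both letters now have cubes, so both alternating words of length four lie in the overlap.
  have h2 : 2 ≤ (evenFactors x p 4 ∩ oddFactors x 4).ncard := by
    refine (Set.ncard_pair (a := [a, a + 1, a, a + 1]) (b := [a + 1, a + 1 + 1, a + 1, a + 1 + 1])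
      fun h => fin_two_add_one_ne a (List.cons.inj h).1.symm).symm.le.trans
      (Set.ncard_le_ncard ?_ hfin)
    rintro _ (rfl | rfl)
    · exact m1
    · exact m2
  omega

/-- Desubstitution keeps the complexity of the Thue–Morse word. -/
theorem ThueMorseComplexity.desubstitute {x : ℕ → Fin 2} {p : ℕ} (hp : p < 2)
    (h : ThueMorseComplexity (shift^[p] (doubling x))) : ThueMorseComplexity x := by
  have hx := cubeFree_of_thueMorseComplexity hp h
  obtain ⟨v2, v3, v4, v5, -⟩ := subwordComplexity_thueMorse_values
  intro n hn
  have key {m : ℕ} (hm : 4 ≤ m) :=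
    subwordComplexity_shift_doubling x (p := p) (m := m) hp (by omega)
  rcases hn.eq_or_lt with rfl | hn
  · have h4 := key (m := 4) le_rfl
    have h5 := key (m := 5) (by omega)
    rw [overlap_eq_empty hx p (by omega), h _ (by omega), Set.ncard_empty] at h4 h5
    norm_num at h4 h5
    have h3 := subwordComplexity_shift_le x hp 3
    have h2 := subwordComplexity_shift_le x hp 2
    have := subwordComplexity_two_le x
    omega
  -- At length 2n - 1 the complexities of `x` and of its shift at n add up to twice the Thue–Morse
  -- value. They differ by at most one, so by parity they are equal.
  · have h1 := key (m := 2 * n - 1) (by omega)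
    have h2 := subwordComplexity_thueMorse_rec (m := 2 * n - 1) (by omega)
    rw [overlap_eq_empty hx p (by omega), h _ (by omega)] at h1
    rw [show (2 * n - 1 + 1) / 2 = n by omega, show (2 * n - 1) / 2 + 1 = n by omega] at h1 h2
    have h3 := subwordComplexity_shift_le x hp n
    rw [Set.ncard_empty] at h1
    omega

/-! ### Right special factors -/

/-- The right special factors of length `n`. -/
def rightSpecial (x : ℕ → Fin 2) (n : ℕ) : Set (List (Fin 2)) :=
  {w | w ++ [0] ∈ factors x (n + 1) ∧ w ++ [1] ∈ factors x (n + 1)}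

theorem rightSpecial_subset_factors (x : ℕ → Fin 2) (n : ℕ) : rightSpecial x n ⊆ factors x n :=
  fun _ hw => mem_factors_of_append_singleton hw.1

theorem rightSpecial_finite (x : ℕ → Fin 2) (n : ℕ) : (rightSpecial x n).Finite :=
  (factors_finite x n).subset (rightSpecial_subset_factors x n)

/-- Let `B a` be the set of factors that `a` can follow. The two sets cover all factors of length n
and meet in the right special ones. -/
theorem subwordComplexity_succ (x : ℕ → Fin 2) (n : ℕ) :
    subwordComplexity x (n + 1) = subwordComplexity x n + (rightSpecial x n).ncard := by
  let B (a : Fin 2) : Set (List (Fin 2)) := {w | w ++ [a] ∈ factors x (n + 1)}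
  have hB (a : Fin 2) : (B a).Finite :=
    (factors_finite x n).subset fun _ hw => mem_factors_of_append_singleton hw
  have hinj (a : Fin 2) : Function.Injective fun w : List (Fin 2) => w ++ [a] :=
    fun _ _ h => List.append_cancel_right h
  have hunion : B 0 ∪ B 1 = factors x n := by
    ext w
    constructor
    · rintro (h | h) <;> exact mem_factors_of_append_singleton h
    · intro h
      obtain ⟨a, ha⟩ := append_singleton_mem_factors h
      rcases fin_two_eq_or a 0 with rfl | rfl
      · exact Or.inl ha
      · exact Or.inr ha
  have hsucc : factors x (n + 1) = (fun w => w ++ [0]) '' B 0 ∪ (fun w => w ++ [1]) '' B 1 := by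
    ext u
    constructor
    · intro hu
      obtain ⟨i, rfl⟩ := id hu
      rw [factor_succ] at hu ⊢
      rcases fin_two_eq_or (x (i + n)) 0 with h | h
      · rw [h] at hu ⊢; exact Or.inl ⟨_, hu, rfl⟩
      · rw [h] at hu ⊢; exact Or.inr ⟨_, hu, rfl⟩
    · rintro (⟨w, hw, rfl⟩ | ⟨w, hw, rfl⟩) <;> exact hw
  have hdisj : Disjoint ((fun w : List (Fin 2) => w ++ [0]) '' B 0)
      ((fun w : List (Fin 2) => w ++ [1]) '' B 1) := by
    rw [Set.disjoint_left]
    rintro _ ⟨w, -, rfl⟩ ⟨v, -, hv⟩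
    simpa using (List.append_inj' hv rfl).2
  have hcard : subwordComplexity x (n + 1) = (B 0).ncard + (B 1).ncard := by
    rw [subwordComplexity, hsucc, Set.ncard_union_eq hdisj ((hB 0).image _) ((hB 1).image _),
      Set.ncard_image_of_injective _ (hinj 0), Set.ncard_image_of_injective _ (hinj 1)]
  have h := Set.ncard_union_add_ncard_inter (B 0) (B 1) (hB 0) (hB 1)
  rw [hunion] at h
  rw [hcard, ← h]
  rfl

theorem mem_rightSpecial_of_cons {x : ℕ → Fin 2} {n : ℕ} {a : Fin 2} {w : List (Fin 2)}
    (h : a :: w ∈ rightSpecial x (n + 1)) : w ∈ rightSpecial x n :=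
  ⟨mem_factors_of_cons h.1, mem_factors_of_cons h.2⟩

theorem exists_cons_of_mem_rightSpecial_succ {x : ℕ → Fin 2} {n : ℕ} {u : List (Fin 2)}
    (h : u ∈ rightSpecial x (n + 1)) : ∃ a w, u = a :: w ∧ w ∈ rightSpecial x n := by
  have hl := length_of_mem_factors (rightSpecial_subset_factors x _ h)
  rcases u with _ | ⟨a, w⟩
  · simp at hl
  · exact ⟨a, w, rfl, mem_rightSpecial_of_cons h⟩

/-- If the number of right special factors doubles, all right special factors extend to the left
by both letters to right special factors. -/
theorem cons_mem_rightSpecial {x : ℕ → Fin 2} {n : ℕ}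
    (h : 2 * (rightSpecial x n).ncard ≤ (rightSpecial x (n + 1)).ncard) {w : List (Fin 2)}
    (hw : w ∈ rightSpecial x n) (a : Fin 2) : a :: w ∈ rightSpecial x (n + 1) := by
  let S := List.cons (0 : Fin 2) '' rightSpecial x n ∪ List.cons (1 : Fin 2) '' rightSpecial x n
  have hfin : S.Finite :=
    ((rightSpecial_finite x n).image _).union ((rightSpecial_finite x n).image _)
  have hsub : rightSpecial x (n + 1) ⊆ S := by
    intro u hu
    obtain ⟨a, w, rfl, hw⟩ := exists_cons_of_mem_rightSpecial_succ hu
    rcases fin_two_eq_or a 0 with rfl | rfl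
    · exact Or.inl ⟨w, hw, rfl⟩
    · exact Or.inr ⟨w, hw, rfl⟩
  have hcard : S.ncard ≤ (rightSpecial x (n + 1)).ncard := by
    refine (Set.ncard_union_le _ _).trans ?_
    rw [Set.ncard_image_of_injective _ List.cons_injective,
      Set.ncard_image_of_injective _ List.cons_injective]
    omega
  rw [Set.eq_of_subset_of_ncard_le hsub hcard hfin]
  rcases fin_two_eq_or a 0 with rfl | rfl
  · exact Or.inl ⟨w, hw, rfl⟩
  · exact Or.inr ⟨w, hw, rfl⟩

/-- Differences of the complexities at lengths 4 to 10. The doublings from 4 to 5 and from 8 to 9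
feed `cons_mem_rightSpecial`; the equality at 7 and 8 makes every right special factor of length
seven extend to the left, once the candidates of length eight have distinct tails. -/
theorem ThueMorseComplexity.ncard_rightSpecial {x : ℕ → Fin 2} (h : ThueMorseComplexity x) :
    (rightSpecial x 4).ncard = 2 ∧ (rightSpecial x 5).ncard = 4 ∧ (rightSpecial x 6).ncard = 4 ∧
    (rightSpecial x 7).ncard = 2 ∧ (rightSpecial x 8).ncard = 2 ∧
    (rightSpecial x 9).ncard = 4 := by
  obtain ⟨-, -, v4, v5, v6, v7, v8, v9, v10⟩ := subwordComplexity_thueMorse_values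
  have h4 := subwordComplexity_succ x 4
  have h5 := subwordComplexity_succ x 5
  have h6 := subwordComplexity_succ x 6
  have h7 := subwordComplexity_succ x 7
  have h8 := subwordComplexity_succ x 8
  have h9 := subwordComplexity_succ x 9
  rw [h _ (by omega), h _ (by omega)] at h4 h5 h6 h7 h8 h9
  norm_num at h4 h5 h6 h7 h8 h9
  omega

/-! ### Words with prescribed factors of length five -/

/-- All factors of length five of the list are in `L`. -/
def locallyIn (L : List (List (Fin 2))) : List (Fin 2) → Bool
  | a :: b :: c :: d :: e :: u => L.contains [a, b, c, d, e] && locallyIn L (b :: c :: d :: e :: u)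
  | _ => true

/-- No factor of length four of the list is in `N`. -/
def avoids (N : List (List (Fin 2))) : List (Fin 2) → Bool
  | a :: b :: c :: d :: u => !N.contains [a, b, c, d] && avoids N (b :: c :: d :: u)
  | _ => true

/-- The condition that right special factors satisfy when the factors of length five are in `L`
and the words in `N` occur at most once. -/
def admissible (L N : List (List (Fin 2))) (w : List (Fin 2)) : Bool :=
  avoids N w && locallyIn L (w ++ [0]) && locallyIn L (w ++ [1])

theorem factor_zero {A : Type*} (ω : ℕ → A) (i : ℕ) : factor ω i 0 = [] := rfl

theorem locallyIn_factor {x : ℕ → Fin 2} {L : List (List (Fin 2))}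
    (hL : ∀ i, factor x i 5 ∈ L) (i n : ℕ) : locallyIn L (factor x i n) = true := by
  induction n generalizing i with
  | zero => rfl
  | succ n ih =>
    rcases n with _ | _ | _ | _ | n
    iterate 4 rfl
    have h1 := ih (i + 1)
    have h5 := hL i
    simp only [factor_succ_left] at h1 h5 ⊢
    simpa [locallyIn, h1, factor_zero] using h5

theorem locallyIn_of_mem_factors {x : ℕ → Fin 2} {L : List (List (Fin 2))}
    (hL : ∀ i, factor x i 5 ∈ L) {n : ℕ} {u : List (Fin 2)} (hu : u ∈ factors x n) :
    locallyIn L u = true := by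
  obtain ⟨i, rfl⟩ := hu; exact locallyIn_factor hL i n

/-- A word of `N` inside a factor that occurs at two positions would itself occur twice. -/
theorem avoids_factor {x : ℕ → Fin 2} {N : List (List (Fin 2))}
    (hN : ∀ v ∈ N, ∀ i j, factor x i 4 = v → factor x j 4 = v → i = j) {i j : ℕ} (hij : i ≠ j)
    (n : ℕ) (h : factor x i n = factor x j n) : avoids N (factor x i n) = true := by
  induction n generalizing i j with
  | zero => rfl
  | succ n ih =>
    rcases n with _ | _ | _ | n
    iterate 3 rfl
    have h' := h
    rw [factor_succ_left, factor_succ_left x j] at h'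
    have h1 := ih (i := i + 1) (j := j + 1) (by omega) (List.cons.inj h').2
    have h4 : factor x i 4 = factor x j 4 := by
      rw [factor_eq_factor_iff] at h ⊢
      exact fun l hl => h l (by omega)
    have hn : factor x i 4 ∉ N := fun hmem => hij (hN _ hmem i j rfl h4.symm)
    simp only [factor_succ_left] at h1 hn ⊢
    have hn' : [x i, x (i + 1), x (i + 1 + 1), x (i + 1 + 1 + 1)] ∉ N := by
      simpa [factor] using hn
    simpa [avoids, h1] using hn'

theorem admissible_of_mem_rightSpecial {x : ℕ → Fin 2} {L N : List (List (Fin 2))}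
    (hL : ∀ i, factor x i 5 ∈ L)
    (hN : ∀ v ∈ N, ∀ i j, factor x i 4 = v → factor x j 4 = v → i = j) {n : ℕ}
    {w : List (Fin 2)} (hw : w ∈ rightSpecial x n) : admissible L N w = true := by
  rw [admissible, Bool.and_eq_true, Bool.and_eq_true]
  refine ⟨⟨?_, locallyIn_of_mem_factors hL hw.1⟩, locallyIn_of_mem_factors hL hw.2⟩
  obtain ⟨⟨i, hi⟩, j, hj⟩ := hw
  rw [factor_succ] at hi hj
  obtain ⟨hi, hi'⟩ := List.append_inj' hi rfl
  obtain ⟨hj, hj'⟩ := List.append_inj' hj rfl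
  have hij : i ≠ j := by
    rintro rfl
    simp only [List.cons.injEq, and_true] at hi' hj'
    rw [← hi'] at hj'
    exact absurd hj' (by decide)
  rw [hi]
  exact avoids_factor hN hij n (hi.symm.trans hj)

theorem mem_binaryWords_of_mem_factors {x : ℕ → Fin 2} {n : ℕ} {w : List (Fin 2)}
    (hw : w ∈ factors x n) : w ∈ binaryWords n := by
  have := mem_binaryWords w
  rwa [length_of_mem_factors hw] at this

/-- A right special factor `r` of length six which has only one possible extension to the left,
not right special, is a prefix. The lists `R` and `P` contain the possible right special factors
of lengths six and eight. -/
theorem prefix_eq_of_rightSpecial {x : ℕ → Fin 2} (hx : ThueMorseComplexity x)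
    {L N R P : List (List (Fin 2))} (hL : ∀ i, factor x i 5 ∈ L)
    (hN : ∀ v ∈ N, ∀ i j, factor x i 4 = v → factor x j 4 = v → i = j)
    (hR : ∀ r ∈ binaryWords 6, admissible L N r = true → r ∈ R)
    (hP : ∀ p ∈ binaryWords 8, admissible L N (0 :: p) = true →
      admissible L N (1 :: p) = true → p ∈ P)
    (hPt : ∀ p ∈ P, ∀ q ∈ P, p.tail = q.tail → p = q) (hlen : R.length ≤ 4)
    {r : List (Fin 2)} (hr : r ∈ R) {c : Fin 2} (hc : locallyIn L ((c + 1) :: r) = false)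
    (hcr : c :: r ∉ P.map List.tail) : factor x 0 6 = r := by
  obtain ⟨-, -, h6, h7, h8, h9⟩ := hx.ncard_rightSpecial
  have hsub6 : rightSpecial x 6 ⊆ R.toFinset := by
    intro w hw
    have := hR w (mem_binaryWords_of_mem_factors (rightSpecial_subset_factors x 6 hw))
      (admissible_of_mem_rightSpecial hL hN hw)
    simpa using this
  -- There are exactly four right special factors of length six and at most four candidates, so
  -- every candidate is right special.
  have heq6 := Set.eq_of_subset_of_ncard_le hsub6
    (by rw [h6, Set.ncard_coe_finset]; exact R.toFinset_card_le.trans hlen) (Finset.finite_toSet _)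
  have hr6 : r ∈ rightSpecial x 6 := by rw [heq6]; simpa using hr
  have hsub8 : rightSpecial x 8 ⊆ {p | p ∈ P} := by
    intro p hp
    have hcons := cons_mem_rightSpecial (n := 8) (by rw [h8, h9]) hp
    exact hP p (mem_binaryWords_of_mem_factors (rightSpecial_subset_factors x 8 hp))
      (admissible_of_mem_rightSpecial hL hN (hcons 0))
      (admissible_of_mem_rightSpecial hL hN (hcons 1))
  have htail : List.tail '' rightSpecial x 8 ⊆ rightSpecial x 7 := by
    rintro _ ⟨p, hp, rfl⟩
    obtain ⟨a, w, rfl, hw⟩ := exists_cons_of_mem_rightSpecial_succ hp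
    exact hw
  have heq7 := Set.eq_of_subset_of_ncard_le htail
    (by
      rw [Set.InjOn.ncard_image fun p hp q hq => hPt p (hsub8 hp) q (hsub8 hq), h7, h8])
    (rightSpecial_finite x 7)
  -- If `r` is not a prefix, both of its right extensions extend to the left, necessarily by `c`. So
  -- `c :: r` is right special of length seven, yet it is not the tail of a candidate of length
  -- eight.
  by_contra hne
  have hext (a : Fin 2) (ha : r ++ [a] ∈ factors x 7) : c :: r ++ [a] ∈ factors x 8 := by
    rcases cons_mem_factors_or_eq_prefix ha with ⟨d, hd⟩ | hpre
    · rcases fin_two_eq_or d c with rfl | rfl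
      · exact hd
      · have h' : ((c + 1) :: r) ++ [a] ∈ factors x 8 := hd
        have := locallyIn_of_mem_factors hL (mem_factors_of_append_singleton h')
        rw [this] at hc
        cases hc
    · rw [factor_succ] at hpre
      exact absurd (List.append_inj' hpre rfl).1.symm hne
  have hcr7 : c :: r ∈ rightSpecial x 7 := ⟨hext 0 hr6.1, hext 1 hr6.2⟩
  rw [← heq7] at hcr7
  obtain ⟨p, hp, hpt⟩ := hcr7
  exact hcr (List.mem_map.2 ⟨p, hsub8 hp, hpt⟩)

theorem four_le_length_of_rightSpecial {x : ℕ → Fin 2} (hx : ThueMorseComplexity x)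
    {L R : List (List (Fin 2))} (hL : ∀ i, factor x i 5 ∈ L)
    (hR : ∀ r ∈ binaryWords 6, admissible L [] r = true → r ∈ R) : 4 ≤ R.length := by
  obtain ⟨-, -, h6, -⟩ := hx.ncard_rightSpecial
  have hsub6 : rightSpecial x 6 ⊆ R.toFinset := by
    intro w hw
    have := hR w (mem_binaryWords_of_mem_factors (rightSpecial_subset_factors x 6 hw))
      (admissible_of_mem_rightSpecial hL (by simp) hw)
    simpa using this
  have := Set.ncard_le_ncard hsub6 (Finset.finite_toSet _)
  rw [h6, Set.ncard_coe_finset] at this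
  exact this.trans R.toFinset_card_le

/-- A prefix without extension to the left occurs only once, and so does the second factor, if
it is always preceded by the same letter. -/
theorem occurs_once_of_prefix {x : ℕ → Fin 2} {L : List (List (Fin 2))}
    (hL : ∀ i, factor x i 5 ∈ L) {v w : List (Fin 2)} (hpre : factor x 0 4 = v)
    (hv : ∀ c, c :: v ∉ L) (hw : ∀ c, c :: w ∈ L → (c :: w).take 4 = v) (hvw : v ≠ w) :
    ∀ u ∈ [v, w], ∀ i j, factor x i 4 = u → factor x j 4 = u → i = j := by
  have h5 (i : ℕ) : x i :: factor x (i + 1) 4 ∈ L := by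
    rw [← factor_succ_left]; exact hL i
  have hv0 (i : ℕ) (hi : factor x i 4 = v) : i = 0 := by
    rcases i with _ | i
    · rfl
    · have := h5 i
      rw [hi] at this
      exact absurd this (hv _)
  have hw1 (i : ℕ) (hi : factor x i 4 = w) : i = 1 := by
    rcases i with _ | i
    · exact absurd (hpre.symm.trans hi) hvw
    · have h := h5 i
      rw [hi] at h
      have ht := hw _ h
      rw [← hi, ← factor_succ_left, factor_succ, List.take_left' (length_factor x i 4)] at ht
      rw [hv0 i ht]
  intro u hu i j hi hj
  have : u = v ∨ u = w := by simpa using hu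
  rcases this with rfl | rfl
  · rw [hv0 i hi, hv0 j hj]
  · rw [hw1 i hi, hw1 j hj]

theorem CubeFree.factors_four_eq {x : ℕ → Fin 2} (hc : CubeFree x) (hx : ThueMorseComplexity x) :
    factors x 4 = ((binaryWords 4).filter cubeFreeList).toFinset := by
  obtain ⟨-, -, v4, -⟩ := subwordComplexity_thueMorse_values
  refine Set.eq_of_subset_of_ncard_le (hc.factors_subset 4) ?_ (Finset.finite_toSet _)
  rw [Set.ncard_coe_finset]
  exact (show _ ≤ 10 by decide).trans ((hx 4 (by omega)).trans v4).ge

theorem CubeFree.notMem_factors {x : ℕ → Fin 2} (hc : CubeFree x) {u : List (Fin 2)} {n : ℕ}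
    (hu : cubeFreeList u = false) : u ∉ factors x n := by
  rintro ⟨i, rfl⟩
  rw [hc.cubeFreeList_factor] at hu
  cases hu

/-- The extensions of the factors of length four. -/
theorem extensions_of_length_four {x : ℕ → Fin 2} (hc : CubeFree x) (hx : ThueMorseComplexity x)
    {u : List (Fin 2)} (hu : u ∈ (binaryWords 4).filter cubeFreeList) :
    (u ++ [0] ∈ factors x 5 ∨ u ++ [1] ∈ factors x 5) ∧
      (0 :: u ∈ factors x 5 ∨ 1 :: u ∈ factors x 5 ∨ factor x 0 4 = u) := by
  have hu4 : u ∈ factors x 4 := by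
    rw [hc.factors_four_eq hx]; simpa using hu
  constructor
  · obtain ⟨a, ha⟩ := append_singleton_mem_factors hu4
    rcases fin_two_eq_or a 0 with rfl | rfl
    · exact Or.inl ha
    · exact Or.inr ha
  · rcases cons_mem_factors_or_eq_prefix hu4 with ⟨a, ha⟩ | h
    · rcases fin_two_eq_or a 0 with rfl | rfl
      · exact Or.inl ha
      · exact Or.inr (Or.inl ha)
    · exact Or.inr (Or.inr h.symm)

theorem not_three_rightSpecial {x : ℕ → Fin 2} (hx : ThueMorseComplexity x) {u v w : List (Fin 2)}
    (huv : u ≠ v) (huw : u ≠ w) (hvw : v ≠ w) (hu : u ∈ rightSpecial x 4)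
    (hv : v ∈ rightSpecial x 4) (hw : w ∈ rightSpecial x 4) : False := by
  have hsub : ({u, v, w} : Set (List (Fin 2))) ⊆ rightSpecial x 4 := by
    rintro _ (rfl | rfl | rfl) <;> assumption
  have h := Set.ncard_le_ncard hsub (rightSpecial_finite x 4)
  rw [Set.ncard_eq_three.2 ⟨u, v, w, huv, huw, hvw, rfl⟩, hx.ncard_rightSpecial.1] at h
  omega

/-- The possible sets of factors of length five, given by the letters that follow `0010`, `1010`,
`0101` and `1101`. -/
def factorsFive (a b c d : Fin 2) : List (List (Fin 2)) :=
  [[0, 0, 1, 1, 0], [0, 1, 0, 0, 1], [0, 1, 1, 0, 0], [0, 1, 1, 0, 1], [1, 0, 0, 1, 0],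
    [1, 0, 0, 1, 1], [1, 0, 1, 1, 0], [1, 1, 0, 0, 1], [0, 0, 1, 0, a], [1, 0, 1, 0, b],
    [0, 1, 0, 1, c], [1, 1, 0, 1, d]]

/-- Of the factors of length four, `0010`, `1010`, `0101` and `1101` determine the next letter; if
two of them with a common suffix of length three are followed by the same letter, the other
extension of that suffix is a prefix of the word. -/
theorem exists_factorsFive {x : ℕ → Fin 2} (hc : CubeFree x) (hx : ThueMorseComplexity x) :
    ∃ a b c d, (∀ i, factor x i 5 ∈ factorsFive a b c d) ∧
      (a = b → factor x 0 4 = [0, 1, 0, a + 1]) ∧ (c = d → factor x 0 4 = [1, 0, 1, c + 1]) := by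
  have hE {u} (hu : u ∈ (binaryWords 4).filter cubeFreeList) := extensions_of_length_four hc hx hu
  obtain ⟨n4, n5, -⟩ := hx.ncard_rightSpecial
  have hcons {w : List (Fin 2)} (hw : w ∈ rightSpecial x 4) (a : Fin 2) :
      a :: w ∈ factors x 5 :=
    rightSpecial_subset_factors x 5 (cons_mem_rightSpecial (n := 4) (by rw [n4, n5]) hw a)
  have c1 : ([0, 0, 0, 1, 0] : List (Fin 2)) ∉ factors x 5 := hc.notMem_factors rfl
  have c2 : ([1, 1, 1, 0, 1] : List (Fin 2)) ∉ factors x 5 := hc.notMem_factors rfl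
  have c3 : ([0, 0, 0, 1, 1] : List (Fin 2)) ∉ factors x 5 := hc.notMem_factors rfl
  have c4 : ([1, 1, 1, 0, 0] : List (Fin 2)) ∉ factors x 5 := hc.notMem_factors rfl
  -- Right special factors of length four extend to the left by both letters, which here would
  -- create a cube.
  have s1 : ([0, 0, 1, 0] : List (Fin 2)) ∉ rightSpecial x 4 := fun h => c1 (hcons h 0)
  have s2 : ([1, 1, 0, 1] : List (Fin 2)) ∉ rightSpecial x 4 := fun h => c2 (hcons h 1)
  obtain ⟨r1, -⟩ := hE (u := [0, 0, 1, 0]) (by decide)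
  obtain ⟨-, l2⟩ := hE (u := [0, 0, 1, 1]) (by decide)
  obtain ⟨-, l1⟩ := hE (u := [0, 0, 1, 0]) (by decide)
  obtain ⟨-, l3⟩ := hE (u := [0, 1, 0, 0]) (by decide)
  obtain ⟨r4, l4⟩ := hE (u := [0, 1, 0, 1]) (by decide)
  obtain ⟨r5, l5⟩ := hE (u := [1, 0, 1, 0]) (by decide)
  obtain ⟨-, l6⟩ := hE (u := [1, 0, 1, 1]) (by decide)
  obtain ⟨-, l7⟩ := hE (u := [1, 1, 0, 0]) (by decide)
  obtain ⟨r8, l8⟩ := hE (u := [1, 1, 0, 1]) (by decide)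
  have t1 := not_three_rightSpecial hx (u := [0, 1, 0, 1]) (v := [1, 0, 1, 0]) (w := [0, 1, 1, 0])
    (by decide) (by decide) (by decide)
  have t2 := not_three_rightSpecial hx (u := [0, 1, 0, 1]) (v := [1, 0, 1, 0]) (w := [1, 0, 0, 1])
    (by decide) (by decide) (by decide)
  have t3 := not_three_rightSpecial hx (u := [0, 1, 0, 1]) (v := [0, 1, 1, 0]) (w := [1, 0, 0, 1])
    (by decide) (by decide) (by decide)
  have t4 := not_three_rightSpecial hx (u := [1, 0, 1, 0]) (v := [0, 1, 1, 0]) (w := [1, 0, 0, 1])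
    (by decide) (by decide) (by decide)
  have p1 (h : factor x 0 4 = [1, 1, 0, 0] ∨ factor x 0 4 = [1, 1, 0, 1])
      (h' : factor x 0 4 = [0, 0, 1, 0] ∨ factor x 0 4 = [0, 0, 1, 1]) : False := by
    rcases h with h | h <;> rcases h' with h' | h' <;> rw [h] at h' <;> revert h' <;> decide
  have p2 (h : factor x 0 4 = [1, 1, 0, 0] ∨ factor x 0 4 = [1, 1, 0, 1])
      (h' : factor x 0 4 = [0, 1, 0, 0] ∨ factor x 0 4 = [1, 0, 1, 1]) : False := by
    rcases h with h | h <;> rcases h' with h' | h' <;> rw [h] at h' <;> revert h' <;> decide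
  have p3 (h : factor x 0 4 = [0, 0, 1, 0] ∨ factor x 0 4 = [0, 0, 1, 1])
      (h' : factor x 0 4 = [0, 1, 0, 0] ∨ factor x 0 4 = [1, 0, 1, 1]) : False := by
    rcases h with h | h <;> rcases h' with h' | h' <;> rw [h] at h' <;> revert h' <;> decide
  -- Both 1100 and 1101 occur, and without a cube only 0 can precede them; so 0110 is right special
  -- unless one of them is the prefix. Dually for 1001 below.
  have e6 : [0, 1, 1, 0] ∈ rightSpecial x 4 ∨
      factor x 0 4 = [1, 1, 0, 0] ∨ factor x 0 4 = [1, 1, 0, 1] := by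
    rcases l7 with h | h | h
    · rcases l8 with h' | h' | h'
      · exact Or.inl ⟨h, h'⟩
      · exact absurd h' c2
      · exact Or.inr (Or.inr h')
    · exact absurd h c4
    · exact Or.inr (Or.inl h)
  have e9 : [1, 0, 0, 1] ∈ rightSpecial x 4 ∨
      factor x 0 4 = [0, 0, 1, 0] ∨ factor x 0 4 = [0, 0, 1, 1] := by
    rcases l1 with h | h | h
    · exact absurd h c1
    · rcases l2 with h' | h' | h'
      · exact absurd h' c3
      · exact Or.inl ⟨h, h'⟩
      · exact Or.inr (Or.inr h')
    · exact Or.inr (Or.inl h)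
  have e69 (h : factor x 0 4 = [0, 1, 0, 0] ∨ factor x 0 4 = [1, 0, 1, 1]) :
      [0, 1, 1, 0] ∈ rightSpecial x 4 ∧ [1, 0, 0, 1] ∈ rightSpecial x 4 :=
    ⟨e6.resolve_right fun h' => p2 h' h, e9.resolve_right fun h' => p3 h' h⟩
  -- With 0101 and 1010 both right special there is no room for 0110 or 1001, and the word would
  -- have two different prefixes.
  have q12 : ¬([0, 1, 0, 1] ∈ rightSpecial x 4 ∧ [1, 0, 1, 0] ∈ rightSpecial x 4) := fun h =>
    p1 (e6.resolve_left fun h' => t1 h.1 h.2 h') (e9.resolve_left fun h' => t2 h.1 h.2 h')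
  -- If 0101 is right special, 00101 and 10101 occur. A letter before 0100 would then make 0010 or
  -- 1010 right special, so 0100 is the prefix; but then 0110 and 1001 are right special too, three
  -- in all.
  have q1 : [0, 1, 0, 1] ∉ rightSpecial x 4 := by
    intro h
    have h' : [1, 0, 1, 0] ∉ rightSpecial x 4 := fun h' => q12 ⟨h, h'⟩
    have hpre : factor x 0 4 = [0, 1, 0, 0] :=
      (l3.resolve_left fun h'' => s1 ⟨h'', hcons h 0⟩).resolve_left
        fun h'' => h' ⟨h'', hcons h 1⟩
    exact t3 h (e69 (Or.inl hpre)).1 (e69 (Or.inl hpre)).2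
  have q2 : [1, 0, 1, 0] ∉ rightSpecial x 4 := by
    intro h
    have hpre : factor x 0 4 = [1, 0, 1, 1] :=
      (l6.resolve_left fun h'' => q1 ⟨hcons h 0, h''⟩).resolve_left
        fun h'' => s2 ⟨hcons h 1, h''⟩
    exact t4 h (e69 (Or.inr hpre)).1 (e69 (Or.inr hpre)).2
  have choice {u : List (Fin 2)} (h : u ++ [0] ∈ factors x 5 ∨ u ++ [1] ∈ factors x 5)
      (hu : u ∉ rightSpecial x 4) : ∃ a, u ++ [a] ∈ factors x 5 ∧ u ++ [a + 1] ∉ factors x 5 := by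
    rcases h with h | h
    · exact ⟨0, h, fun h' => hu ⟨h, h'⟩⟩
    · exact ⟨1, h, fun h' => hu ⟨h', h⟩⟩
  obtain ⟨a, ha, ha'⟩ := choice r1 s1
  obtain ⟨b, hb, hb'⟩ := choice r5 q2
  obtain ⟨c, hd, hd'⟩ := choice r4 q1
  obtain ⟨d, he, he'⟩ := choice r8 s2
  refine ⟨a, b, c, d, fun i => ?_, ?_, ?_⟩
  · have hlist : ∀ a b c d, ∀ w ∈ (binaryWords 5).filter cubeFreeList,
        w = [0, 0, 1, 0, a + 1] ∨ w = [1, 0, 1, 0, b + 1] ∨ w = [0, 1, 0, 1, c + 1] ∨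
          w = [1, 1, 0, 1, d + 1] ∨ w ∈ factorsFive a b c d := by decide +kernel
    have hi : factor x i 5 ∈ (binaryWords 5).filter cubeFreeList := by
      simpa using hc.factors_subset 5 (factor_mem_factors x i 5)
    have hm := factor_mem_factors x i 5
    rcases hlist a b c d _ hi with h | h | h | h | h
    · rw [h] at hm; exact absurd hm ha'
    · rw [h] at hm; exact absurd hm hb'
    · rw [h] at hm; exact absurd hm hd'
    · rw [h] at hm; exact absurd hm he'
    · exact h
  · rintro rfl
    rcases fin_two_eq_or a 0 with rfl | rfl
    · exact (l4.resolve_left ha').resolve_left hb'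
    · exact (l3.resolve_left ha').resolve_left hb'
  · rintro rfl
    rcases fin_two_eq_or c 0 with rfl | rfl
    · exact (l6.resolve_left hd').resolve_left he'
    · exact (l5.resolve_left hd').resolve_left he'

theorem false_of_two_prefixes {x : ℕ → Fin 2} (hx : ThueMorseComplexity x)
    {L R P : List (List (Fin 2))} (hL : ∀ i, factor x i 5 ∈ L) {r r' : List (Fin 2)} {c c' : Fin 2}
    (hR : ∀ r ∈ binaryWords 6, admissible L [] r = true → r ∈ R)
    (hP : ∀ p ∈ binaryWords 8, admissible L [] (0 :: p) = true →
      admissible L [] (1 :: p) = true → p ∈ P)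
    (hPt : ∀ p ∈ P, ∀ q ∈ P, p.tail = q.tail → p = q) (hlen : R.length ≤ 4)
    (hr : r ∈ R) (hc : locallyIn L ((c + 1) :: r) = false) (hcr : c :: r ∉ P.map List.tail)
    (hr' : r' ∈ R) (hc' : locallyIn L ((c' + 1) :: r') = false)
    (hcr' : c' :: r' ∉ P.map List.tail) (hrr : r ≠ r') : False :=
  hrr ((prefix_eq_of_rightSpecial hx hL (by simp) hR hP hPt hlen hr hc hcr).symm.trans
    (prefix_eq_of_rightSpecial hx hL (by simp) hR hP hPt hlen hr' hc' hcr'))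

theorem false_of_prefix {x : ℕ → Fin 2} (hx : ThueMorseComplexity x)
    {L R P : List (List (Fin 2))} (hL : ∀ i, factor x i 5 ∈ L) {v w r : List (Fin 2)} {c : Fin 2}
    (hpre : factor x 0 4 = v) (hv : ∀ c, c :: v ∉ L)
    (hw : ∀ c, c :: w ∈ L → (c :: w).take 4 = v) (hvw : v ≠ w)
    (hR : ∀ r ∈ binaryWords 6, admissible L [v, w] r = true → r ∈ R)
    (hP : ∀ p ∈ binaryWords 8, admissible L [v, w] (0 :: p) = true →
      admissible L [v, w] (1 :: p) = true → p ∈ P)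
    (hPt : ∀ p ∈ P, ∀ q ∈ P, p.tail = q.tail → p = q) (hlen : R.length ≤ 4)
    (hr : r ∈ R) (hc : locallyIn L ((c + 1) :: r) = false) (hcr : c :: r ∉ P.map List.tail)
    (hrv : r.take 4 ≠ v) : False := by
  have h := prefix_eq_of_rightSpecial hx hL (occurs_once_of_prefix hL hpre hv hw hvw) hR hP hPt
    hlen hr hc hcr
  rw [← h, show 6 = 4 + 2 from rfl, factor_add, List.take_left' (length_factor x 0 4)] at hrv
  exact hrv hpre

/-! ### The choices of continuations that do not occur -/

theorem not_factorsFive_0001 {x : ℕ → Fin 2} (hx : ThueMorseComplexity x)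
    (hL : ∀ i, factor x i 5 ∈ factorsFive 0 0 0 1)
    (hpre : factor x 0 4 = [0, 1, 0, 1]) : False := by
  -- Nothing can precede 0101, and 1010 can only be preceded by 0, which makes 0101 start one place
  -- earlier; so each of them occurs only once. The lists are the candidates under this restriction.
  refine false_of_prefix hx hL hpre (w := [1, 0, 1, 0])
    (R := [[0, 0, 1, 0, 0, 1], [0, 1, 1, 0, 0, 1], [1, 0, 0, 1, 1, 0], [1, 1, 0, 1, 1, 0]])
    (P := [[0, 1, 1, 0, 0, 1, 1, 0], [1, 0, 0, 1, 1, 0, 0, 1]])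
    (r := [0, 0, 1, 0, 0, 1]) (c := 1)
    ?_ ?_ ?_ ?_ ?_ ?_ ?_ ?_ ?_ ?_ ?_ <;> decide +kernel

theorem not_factorsFive_0010 {x : ℕ → Fin 2} (hx : ThueMorseComplexity x)
    (hL : ∀ i, factor x i 5 ∈ factorsFive 0 0 1 0)
    (hpre : factor x 0 4 = [0, 1, 0, 1]) : False := by
  refine false_of_prefix hx hL hpre (w := [1, 0, 1, 1])
    (R := [[0, 0, 1, 0, 0, 1], [0, 1, 1, 0, 0, 1], [1, 0, 0, 1, 1, 0], [1, 0, 1, 0, 0, 1]])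
    (P := [[0, 1, 0, 0, 1, 0, 0, 1], [1, 0, 0, 1, 1, 0, 0, 1]])
    (r := [1, 0, 1, 0, 0, 1]) (c := 1)
    ?_ ?_ ?_ ?_ ?_ ?_ ?_ ?_ ?_ ?_ ?_ <;> decide +kernel

/-- Three candidates remain at length six, where four right special factors are needed. -/
theorem not_factorsFive_0100 {x : ℕ → Fin 2} (hx : ThueMorseComplexity x)
    (hL : ∀ i, factor x i 5 ∈ factorsFive 0 1 0 0) : False := by
  have h := four_le_length_of_rightSpecial hx hL
    (R := [[0, 0, 1, 0, 0, 1], [0, 1, 1, 0, 0, 1], [1, 0, 0, 1, 1, 0]]) (by decide +kernel)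
  revert h; decide

/-- Two different words of length six would both have to be the prefix. -/
theorem not_factorsFive_0101 {x : ℕ → Fin 2} (hx : ThueMorseComplexity x)
    (hL : ∀ i, factor x i 5 ∈ factorsFive 0 1 0 1) : False := by
  refine false_of_two_prefixes hx hL
    (R := [[0, 0, 1, 0, 0, 1], [0, 1, 1, 0, 0, 1], [1, 0, 0, 1, 1, 0], [1, 1, 0, 1, 1, 0]])
    (P := [[0, 1, 1, 0, 0, 1, 1, 0], [1, 0, 0, 1, 1, 0, 0, 1]])
    (r := [0, 0, 1, 0, 0, 1]) (c := 1) (r' := [1, 1, 0, 1, 1, 0]) (c' := 0)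
    ?_ ?_ ?_ ?_ ?_ ?_ ?_ ?_ ?_ ?_ ?_ <;> decide +kernel

theorem not_factorsFive_0110 {x : ℕ → Fin 2} (hx : ThueMorseComplexity x)
    (hL : ∀ i, factor x i 5 ∈ factorsFive 0 1 1 0) : False := by
  refine false_of_two_prefixes hx hL
    (R := [[0, 0, 1, 0, 0, 1], [0, 1, 0, 1, 1, 0], [0, 1, 1, 0, 0, 1], [1, 0, 0, 1, 1, 0]])
    (P := [[0, 1, 1, 0, 0, 1, 1, 0], [1, 0, 0, 1, 1, 0, 0, 1]])
    (r := [0, 0, 1, 0, 0, 1]) (c := 1) (r' := [0, 1, 0, 1, 1, 0]) (c' := 1)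
    ?_ ?_ ?_ ?_ ?_ ?_ ?_ ?_ ?_ ?_ ?_ <;> decide +kernel

theorem not_factorsFive_0111 {x : ℕ → Fin 2} (hx : ThueMorseComplexity x)
    (hL : ∀ i, factor x i 5 ∈ factorsFive 0 1 1 1)
    (hpre : factor x 0 4 = [1, 0, 1, 0]) : False := by
  refine false_of_prefix hx hL hpre (w := [0, 1, 0, 1])
    (R := [[0, 0, 1, 0, 0, 1], [0, 1, 1, 0, 0, 1], [1, 0, 0, 1, 1, 0], [1, 1, 0, 1, 1, 0]])
    (P := [[0, 1, 1, 0, 0, 1, 1, 0], [1, 0, 0, 1, 1, 0, 0, 1]])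
    (r := [0, 0, 1, 0, 0, 1]) (c := 1)
    ?_ ?_ ?_ ?_ ?_ ?_ ?_ ?_ ?_ ?_ ?_ <;> decide +kernel

theorem not_factorsFive_1000 {x : ℕ → Fin 2} (hx : ThueMorseComplexity x)
    (hL : ∀ i, factor x i 5 ∈ factorsFive 1 0 0 0) : False := by
  have h := four_le_length_of_rightSpecial hx hL
    (R := [[0, 1, 1, 0, 0, 1], [1, 0, 0, 1, 1, 0], [1, 0, 1, 0, 0, 1]]) (by decide +kernel)
  revert h; decide

theorem not_factorsFive_1001 {x : ℕ → Fin 2} (hx : ThueMorseComplexity x)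
    (hL : ∀ i, factor x i 5 ∈ factorsFive 1 0 0 1) : False := by
  refine false_of_two_prefixes hx hL
    (R := [[0, 1, 1, 0, 0, 1], [1, 0, 0, 1, 1, 0], [1, 0, 1, 0, 0, 1], [1, 1, 0, 1, 1, 0]])
    (P := [[0, 1, 1, 0, 0, 1, 1, 0], [1, 0, 0, 1, 1, 0, 0, 1]])
    (r := [1, 0, 1, 0, 0, 1]) (c := 0) (r' := [1, 1, 0, 1, 1, 0]) (c' := 0)
    ?_ ?_ ?_ ?_ ?_ ?_ ?_ ?_ ?_ ?_ ?_ <;> decide +kernel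

theorem not_factorsFive_1011 {x : ℕ → Fin 2} (hx : ThueMorseComplexity x)
    (hL : ∀ i, factor x i 5 ∈ factorsFive 1 0 1 1)
    (hpre : factor x 0 4 = [1, 0, 1, 0]) : False := by
  refine false_of_prefix hx hL hpre (w := [0, 1, 0, 0])
    (R := [[0, 1, 0, 1, 1, 0], [0, 1, 1, 0, 0, 1], [1, 0, 0, 1, 1, 0], [1, 1, 0, 1, 1, 0]])
    (P := [[0, 1, 1, 0, 0, 1, 1, 0], [1, 0, 1, 1, 0, 1, 1, 0]])
    (r := [0, 1, 0, 1, 1, 0]) (c := 0)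
    ?_ ?_ ?_ ?_ ?_ ?_ ?_ ?_ ?_ ?_ ?_ <;> decide +kernel

theorem not_factorsFive_1101 {x : ℕ → Fin 2} (hx : ThueMorseComplexity x)
    (hL : ∀ i, factor x i 5 ∈ factorsFive 1 1 0 1) : False := by
  have h := four_le_length_of_rightSpecial hx hL
    (R := [[0, 1, 1, 0, 0, 1], [1, 0, 0, 1, 1, 0], [1, 1, 0, 1, 1, 0]]) (by decide +kernel)
  revert h; decide

theorem not_factorsFive_1110 {x : ℕ → Fin 2} (hx : ThueMorseComplexity x)
    (hL : ∀ i, factor x i 5 ∈ factorsFive 1 1 1 0) : False := by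
  have h := four_le_length_of_rightSpecial hx hL
    (R := [[0, 1, 0, 1, 1, 0], [0, 1, 1, 0, 0, 1], [1, 0, 0, 1, 1, 0]]) (by decide +kernel)
  revert h; decide

theorem CubeFree.factor_five_mem {x : ℕ → Fin 2} (hc : CubeFree x) (hx : ThueMorseComplexity x)
    (i : ℕ) : factor x i 5 ∈ factorsFive 1 0 1 0 := by
  obtain ⟨a, b, c, d, hL, hab, hcd⟩ := exists_factorsFive hc hx
  -- Two coincidences would force a prefix beginning with 0 and one beginning with 1. This removes
  -- four of the sixteen choices; the lemmas above remove eleven others.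
  have hboth : ¬(a = b ∧ c = d) := by
    rintro ⟨h, h'⟩
    have := (hab h).symm.trans (hcd h')
    simp at this
  rcases fin_two_eq_or a 0 with rfl | rfl <;> rcases fin_two_eq_or b 0 with rfl | rfl <;>
    rcases fin_two_eq_or c 0 with rfl | rfl <;> rcases fin_two_eq_or d 0 with rfl | rfl <;>
    simp only [zero_add, and_true, true_and, not_true_eq_false, forall_const] at *
  · exact (not_factorsFive_0001 hx hL hab).elim
  · exact (not_factorsFive_0010 hx hL hab).elim
  · exact (not_factorsFive_0100 hx hL).elim
  · exact (not_factorsFive_0101 hx hL).elim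
  · exact (not_factorsFive_0110 hx hL).elim
  · exact (not_factorsFive_0111 hx hL hcd).elim
  · exact (not_factorsFive_1000 hx hL).elim
  · exact (not_factorsFive_1001 hx hL).elim
  · exact hL i
  · exact (not_factorsFive_1011 hx hL hcd).elim
  · exact (not_factorsFive_1101 hx hL).elim
  · exact (not_factorsFive_1110 hx hL).elim

/-- All squares of letters start at positions of the same parity: two squares cannot be at distance
one or three, and the next square is at distance two or four. -/
theorem aligned_of_cubeFree {x : ℕ → Fin 2} (hc : CubeFree x) (hx : ThueMorseComplexity x) :
    Aligned x := by
  have h5 (i : ℕ) := hc.factor_five_mem hx i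
  have hstep (i : ℕ) (hi : x i = x (i + 1)) : x (i + 1) ≠ x (i + 2) ∧ x (i + 3) ≠ x (i + 4) ∧
      (x (i + 2) = x (i + 3) ∨ x (i + 4) = x (i + 5)) := by
    have h0 := h5 i
    have h1 := h5 (i + 1)
    simp only [factor, List.range_succ, List.range_zero, List.nil_append, List.map_cons,
      List.cons_append, List.map_nil, Nat.add_assoc, Nat.reduceAdd, Nat.add_zero] at h0 h1
    rw [← hi] at h0 h1 ⊢
    generalize x i = a at *
    generalize x (i + 2) = b at *
    generalize x (i + 3) = c at *
    generalize x (i + 4) = d at *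
    generalize x (i + 5) = e at *
    clear hi h5 hc hx
    revert a b c d e
    decide +kernel
  have hodd (j : ℕ) : ∀ i, x i = x (i + 1) → x (i + 2 * j + 1) ≠ x (i + 2 * j + 2) := by
    induction j using Nat.strong_induction_on with
    | _ j ih =>
      intro i hi
      obtain ⟨s1, s3, s⟩ := hstep i hi
      rcases j with _ | _ | j
      · exact s1
      · exact s3
      -- A square at distance two or four from `i` brings the two squares closer without changing
      -- the parity of their distance.
      · rcases s with s | s
        · have := ih (j + 1) (by omega) (i + 2) s
          rwa [show i + 2 + 2 * (j + 1) = i + 2 * (j + 1 + 1) by omega] at this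
        · have := ih j (by omega) (i + 4) s
          rwa [show i + 4 + 2 * j = i + 2 * (j + 1 + 1) by omega] at this
  -- Without squares the word would alternate, but neither 01010 nor 10101 is in the list.
  obtain ⟨q, hq⟩ : ∃ q, x q = x (q + 1) := by
    by_contra! hne
    have h0 := h5 0
    have e0 := hne 0
    have e1 := hne 1
    have e2 := hne 2
    have e3 := hne 3
    simp only [factor, List.range_succ, List.range_zero, List.nil_append, List.map_cons,
      List.cons_append, List.map_nil, Nat.reduceAdd] at h0 e0 e1 e2 e3
    generalize x 0 = a at *
    generalize x 1 = b at *
    generalize x 2 = c at *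
    generalize x 3 = d at *
    generalize x 4 = e at *
    clear hstep h5 hodd hc hx hne
    revert a b c d e
    decide +kernel
  refine aligned_of_parity (q := q + 1) fun n hn hn' => ?_
  rcases Nat.lt_or_ge n q with hlt | hge
  · have h := hodd ((q - n - 1) / 2) n hn'
    rw [show n + 2 * ((q - n - 1) / 2) + 1 = q by omega,
      show n + 2 * ((q - n - 1) / 2) + 2 = q + 1 by omega] at h
    exact h hq
  · have h := hodd ((n - q - 1) / 2) q hq
    rw [show q + 2 * ((n - q - 1) / 2) + 1 = n by omega,
      show q + 2 * ((n - q - 1) / 2) + 2 = n + 1 by omega] at h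
    exact h hn'

/-! ### Descent to the Thue–Morse word -/

theorem doubling_eq_of_eq {x y : ℕ → Fin 2} {i j n : ℕ} (e : ℕ)
    (h : ∀ l < (e + n + 1) / 2, x (i + l) = y (j + l)) :
    ∀ l < n, doubling x (2 * i + e + l) = doubling y (2 * j + e + l) := by
  intro l hl
  have hl' := h ((e + l) / 2) (by omega)
  rw [doubling, doubling, show (2 * i + e + l) / 2 = i + (e + l) / 2 by omega,
    show (2 * j + e + l) / 2 = j + (e + l) / 2 by omega,
    show (2 * i + e + l) % 2 = (e + l) % 2 by omega,
    show (2 * j + e + l) % 2 = (e + l) % 2 by omega, hl']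

/-- An aligned word with the complexity of the Thue–Morse word has only factors of the
Thue–Morse word. -/
theorem exists_occurrence_thueMorse (n : ℕ) : ∀ {ω : ℕ → Fin 2}, Aligned ω →
    ThueMorseComplexity ω → ∀ i, ∃ k, ∀ l < n, ω (i + l) = thueMorse (k + l) := by
  induction n using Nat.strong_induction_on with
  | _ n ih =>
    intro ω hal hω i
    rcases Nat.lt_or_ge n 3 with hn | hn
    -- Length two belongs to the base case, since a factor of length two at an odd position of the
    -- image meets two blocks and does not get shorter.
    · have hmem : factor ω i 2 ∈ factors thueMorse 2 := by
        rw [factors_thueMorse_two]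
        exact factors_subset_binaryWords ω 2 (factor_mem_factors ω i 2)
      obtain ⟨k, hk⟩ := hmem
      rw [factor_eq_factor_iff] at hk
      exact ⟨k, fun l hl => hk l (by omega)⟩
    · obtain ⟨p, hp, x, rfl⟩ := hal
      have hx := hω.desubstitute hp
      have hxc := cubeFree_of_thueMorseComplexity hp hω
      set e := (i + p) % 2 with he
      obtain ⟨k, hk⟩ := ih ((e + n + 1) / 2) (by omega) (aligned_of_cubeFree hxc hx) hx
        ((i + p) / 2)
      refine ⟨2 * k + e, fun l hl => ?_⟩
      have h := doubling_eq_of_eq e hk l hl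
      rw [doubling_thueMorse] at h
      rw [shift_iterate_apply, ← h]
      congr 1; omega

/-! ### The shift orbit closure and recurrence -/

theorem mem_shiftOrbitClosure_iff (ω ν : ℕ → Fin 2) :
    ω ∈ shiftOrbitClosure ν ↔ ∀ n, ∃ k, ∀ l < n, ω l = ν (k + l) := by
  rw [shiftOrbitClosure, (PiNat.isTopologicalBasis_cylinders fun _ => Fin 2).mem_closure_iff]
  constructor
  · intro h n
    obtain ⟨_, hy, k, rfl⟩ := h _ ⟨ω, n, rfl⟩ (PiNat.self_mem_cylinder ω n)
    refine ⟨k, fun l hl => ?_⟩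
    rw [PiNat.mem_cylinder_iff] at hy
    rw [← hy l hl, add_comm]
    exact shift_iterate_apply ν k l
  · rintro h _ ⟨y, n, rfl⟩ hω
    obtain ⟨k, hk⟩ := h n
    refine ⟨shift^[k] ν, ?_, k, rfl⟩
    rw [PiNat.mem_cylinder_iff] at hω ⊢
    intro l hl
    rw [shift_iterate_apply, add_comm, ← hk l hl, hω l hl]

/-- The Thue–Morse word is the binary digit sum modulo two, and the digits of 2^k m + j are those of
m followed by those of j, padded with zeros. -/
theorem thueMorse_pow_mul_add (k m j : ℕ) (hj : j < 2 ^ k) :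
    thueMorse (2 ^ k * m + j) = thueMorse m + thueMorse j := by
  induction k generalizing j with
  | zero =>
    have : j = 0 := by simpa using hj
    rw [this, thueMorse_spec.1]; simp
  | succ k ih =>
    have hj' : j / 2 < 2 ^ k := by rw [pow_succ] at hj; omega
    have h := ih (j / 2) hj'
    have hp : 2 ^ (k + 1) * m = 2 * (2 ^ k * m) := by ring
    rcases Nat.even_or_odd' j with ⟨c, rfl | rfl⟩
    · rw [show 2 * c / 2 = c by omega] at h
      rw [hp, ← mul_add, thueMorse_even, h, thueMorse_even]
    · rw [show (2 * c + 1) / 2 = c by omega] at h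
      rw [hp, ← add_assoc, ← mul_add, thueMorse_odd, h, thueMorse_odd, add_assoc]

/-- Every prefix of the Thue–Morse word occurs in it with bounded gaps. -/
theorem thueMorse_prefix_recurs (k a : ℕ) :
    ∃ b, a ≤ b ∧ b ≤ a + 3 * 2 ^ k ∧ ∀ j < 2 ^ k, thueMorse (b + j) = thueMorse j := by
  -- Each block contains a 0, so a zero can be chosen in the first block that starts beyond `a / 2 ^
  -- k`.
  obtain ⟨m, hm, hm', h0⟩ : ∃ m, a / 2 ^ k + 1 ≤ m ∧ m ≤ a / 2 ^ k + 3 ∧ thueMorse m = 0 := by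
    have h : (a / 2 ^ k + 1) ≤ 2 * ((a / 2 ^ k + 2) / 2) := by omega
    rcases fin_two_eq_or (thueMorse ((a / 2 ^ k + 2) / 2)) 0 with h' | h'
    · exact ⟨2 * ((a / 2 ^ k + 2) / 2), h, by omega, by rw [thueMorse_even, h']⟩
    · exact ⟨2 * ((a / 2 ^ k + 2) / 2) + 1, by omega, by omega, by rw [thueMorse_odd, h']; rfl⟩
  have hd := Nat.div_add_mod a (2 ^ k)
  have hmod := Nat.mod_lt a (Nat.two_pow_pos k)
  have h1 := Nat.mul_le_mul_left (2 ^ k) hm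
  have h2 := Nat.mul_le_mul_left (2 ^ k) hm'
  rw [mul_add] at h1 h2
  refine ⟨2 ^ k * m, by omega, by omega, fun j hj => ?_⟩
  rw [thueMorse_pow_mul_add k m j hj, h0, zero_add]

/-- The words in the shift orbit closure have the same factors as the Thue–Morse word. -/
theorem factors_eq_of_mem_shiftOrbitClosure {ω : ℕ → Fin 2} (h : ω ∈ shiftOrbitClosure thueMorse)
    (n : ℕ) : factors ω n = factors thueMorse n := by
  rw [mem_shiftOrbitClosure_iff] at h
  refine Set.Subset.antisymm ?_ ?_
  · rintro _ ⟨i, rfl⟩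
    obtain ⟨k, hk⟩ := h (i + n)
    refine ⟨k + i, (factor_eq_factor_iff _ _ _ _ _).2 fun l hl => ?_⟩
    rw [hk _ (by omega), add_assoc]
  · rintro _ ⟨i, rfl⟩
    have hpow : i + n < 2 ^ (i + n) := Nat.lt_two_pow_self
    -- The next occurrence of the prefix of length 2^(i+n) starts at most 3 · 2^(i+n) places later,
    -- so a window of four times its length contains it entirely.
    obtain ⟨a, ha⟩ := h (4 * 2 ^ (i + n))
    obtain ⟨b, hab, hb, hrec⟩ := thueMorse_prefix_recurs (i + n) a
    refine ⟨b - a + i, (factor_eq_factor_iff _ _ _ _ _).2 fun l hl => ?_⟩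
    rw [ha _ (by omega), ← hrec _ (by omega)]
    congr 1; omega

end AbelianWords

theorem corollary6p3 (ω : ℕ → Fin 2) :
    (AbelianWords.subwordComplexity ω =
        AbelianWords.subwordComplexity AbelianWords.thueMorse ∧
      AbelianWords.abelianComplexity ω =
        AbelianWords.abelianComplexity AbelianWords.thueMorse) ↔
      ω ∈ AbelianWords.shiftOrbitClosure AbelianWords.thueMorse := by
  constructor
  · rintro ⟨hs, ha⟩
    have hal : AbelianWords.Aligned ω := AbelianWords.aligned_of_abelianComplexity
      (by rw [ha, AbelianWords.abelianComplexity_thueMorse_two])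
      fun n => by rw [ha, AbelianWords.abelianComplexity_thueMorse_odd]
    rw [AbelianWords.mem_shiftOrbitClosure_iff]
    intro n
    obtain ⟨k, hk⟩ := AbelianWords.exists_occurrence_thueMorse n hal (fun n _ => by rw [hs]) 0
    exact ⟨k, fun l hl => by rw [← hk l hl, zero_add]⟩
  · intro h
    have hf := AbelianWords.factors_eq_of_mem_shiftOrbitClosure h
    constructor
    · funext n
      rw [AbelianWords.subwordComplexity, AbelianWords.subwordComplexity, hf]
    · funext n
      rw [AbelianWords.abelianComplexity, AbelianWords.abelianComplexity, hf]
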